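/- Let $X$ be a compact metric space, $\phi : X \to X$ a homeomorphism, $F : X \to \mathbb R$ a continuous function and $\beta \in \mathbb R$. Put $S_0(F)=0$, $S_k(F)=\sum_{j=0}^{k-1}F\circ\phi^j$ for $k\ge 1$, and $S_k(F)=-\sum_{j=1}^{|k|}F\circ\phi^{-j}$ for $k\le -1$. A Borel probability measure $m$ on $X$ is $e^{\beta F}$-conformal if $m(\phi(B))=\int_B e^{\beta F}\,\mathrm dm$ for all Borel sets $B\subseteq X$, and ergodic if $m(B)=0$ or $m(X\setminus B)=0$ for every Borel set $B$ with $\phi^{-1}(B)=B$. A periodic orbit with minimal period $p$ is $F$-cyclic if $\sum_{i=1}^{p}F(\phi^i(x))=0$ for $x$ in the orbit. Define, for $p\in\{1,2,\dots\}$, $$M_{I_p}=\{x:\ \phi^p(x)=x,\ \phi^j(x)\ne x \text{ for } 1\le j<p,\ S_p(F)(x)=0\},\qquad M_{I_\infty}=\Big\{x:\ \sum_{n\in\mathbb Z}e^{\beta S_n(F)(x)}<\infty\Big\},$$ $$M_I=M_{I_\infty}\cup\bigcup_{p\ge 1}M_{I_p},\qquad M_{II_1}=\Big\{x:\ \liminf_{n}\frac1n\sum_{j=1}^n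 e^{\beta S_j(F)(x)}>0\Big\}\setminus M_I .$$ Let $M_{III}$ be a Borel set with $\phi^{-1}(M_{III})=M_{III}$ such that (a) there is a Borel function $u:X\setminus M_{III}\to\mathbb R$ with $\beta F=u\circ\phi-u$ on $X\setminus M_{III}$, and (b) $m(A)=0$ whenever $A\subseteq M_{III}$ is a $\phi$-invariant Borel set that admits a Borel function $u:A\to\mathbb R$ with $\beta F=u\circ\phi-u$ on $A$; such a set exists and is unique up to $m$-null sets. Put $M_{II_\infty}=X\setminus(M_I\cup M_{II_1}\cup M_{III})$. For $t\in\{I_p, I_\infty, II_1, II_\infty, III\}$ the measure $m$ is of type $t$ if $m(M_t)=1$. Two measures are equivalent if they have the same null sets, and a measure is atomic if it is concentrated on a countable set. Theorem. Let $m$ be an ergodic $e^{\beta F}$-conformal measure. - For every $p\ge 1$: $m$ is of type $I_p$ if and only if $m$ is atomic and concentrated on an $F$-cyclic $\phi$-orbit with minimal period $p$. - $m$ is of type $I_\infty$ if and only if $m$ is atomic and concentrated on a single infinite $\phi$-orbit. - Assume, in case $\beta=0$, that $m$ is not concentrated on a finite $\phi$-orbit that is not $F$-cyclic. Then $m$ is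 of type $II_1$ if and only if $m$ is equivalent to a $\phi$-invariant non-atomic Borel probability measure. - $m$ is of type $II_\infty$ if and only if $m$ is equivalent to an infinite $\sigma$-finite non-atomic $\phi$-invariant Borel measure. - $m$ is of type $III$ if and only if $m$ is singular with respect to every $\sigma$-finite $\phi$-invariant Borel measure. -/

import Mathlib

open MeasureTheory Filter
open scoped ENNReal

namespace ConformalType

variable {X : Type*}

/-- The two-sided Birkhoff sums `S_k(F)`, `k ∈ ℤ`: for `k ≥ 0` this is
`∑_{j=0}^{k-1} F ∘ φ^j`, and for `k ≤ -1` it is `-∑_{j=1}^{|k|} F ∘ φ^{-j}`. -/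
def S (φ : X ≃ X) (F : X → ℝ) : ℤ → X → ℝ
  | Int.ofNat n => fun x => ∑ j ∈ Finset.range n, F (φ^[j] x)
  | Int.negSucc n => fun x => -∑ j ∈ Finset.Icc 1 (n + 1), F (φ.symm^[j] x)

/-- The full orbit `{φ^k(x) : k ∈ ℤ}`. -/
def orbit (φ : X ≃ X) (x : X) : Set X :=
  Set.range fun k : ℤ => ((φ : Equiv.Perm X) ^ k) x

/-- `x` is a periodic point and its orbit is `F`-cyclic: the sum of `F` over the (finite) orbit,
taken over the minimal period, is zero. -/
def IsFCyclic (φ : X ≃ X) (F : X → ℝ) (x : X) : Prop :=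
  x ∈ Function.periodicPts φ ∧
    ∑ i ∈ Finset.Icc 1 (Function.minimalPeriod φ x), F (φ^[i] x) = 0

/-- `M_{I_p}`, for `p ≥ 1`. -/
def MIp (φ : X ≃ X) (F : X → ℝ) (p : ℕ) : Set X :=
  {x | φ^[p] x = x ∧ (∀ j : ℕ, 1 ≤ j → j < p → φ^[j] x ≠ x) ∧ S φ F p x = 0}

/-- `M_{I_∞}`. All terms of the series are positive. -/
def MIinf (φ : X ≃ X) (F : X → ℝ) (β : ℝ) : Set X :=
  {x | Summable fun n : ℤ => Real.exp (β * S φ F n x)}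

/-- `M_I = M_{I_∞} ∪ ⋃_{p ≥ 1} M_{I_p}`. -/
def MI (φ : X ≃ X) (F : X → ℝ) (β : ℝ) : Set X :=
  MIinf φ F β ∪ ⋃ p ∈ Set.Ici (1 : ℕ), MIp φ F p

/-- `M_{II_1}`. The lower limit of the positive averages is taken in `[0, ∞]`, since it may
be infinite. -/
def MII1 (φ : X ≃ X) (F : X → ℝ) (β : ℝ) : Set X :=
  {x | 0 < liminf (fun n : ℕ =>
      ENNReal.ofReal ((1 / (n : ℝ)) * ∑ j ∈ Finset.Icc 1 n, Real.exp (β * S φ F (j : ℤ) x)))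
      atTop} \ MI φ F β

variable [MeasurableSpace X]

/-- `m` is an `e^{βF}`-conformal measure: a probability measure with
`m(φ(B)) = ∫_B e^{βF} dm` for all measurable `B`. -/
structure IsConformal (φ : X ≃ X) (F : X → ℝ) (β : ℝ) (m : Measure X) : Prop where
  prob : IsProbabilityMeasure m
  map_image : ∀ B : Set X, MeasurableSet B →
    m (φ '' B) = ∫⁻ x in B, ENNReal.ofReal (Real.exp (β * F x)) ∂m

/-- `M` is a possible choice of the set `M_{III}` for `m`; such a set is unique up to
`m`-null sets. Borel functions on an invariant Borel set are written as Borel functions on the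
whole space of which only the values on that set matter. -/
structure IsMIII (φ : X ≃ X) (F : X → ℝ) (β : ℝ) (m : Measure X) (M : Set X) : Prop where
  measurableSet : MeasurableSet M
  invariant : φ ⁻¹' M = M
  exists_off : ∃ u : X → ℝ, Measurable u ∧ ∀ x ∈ Mᶜ, β * F x = u (φ x) - u x
  null_of_sub : ∀ A : Set X, A ⊆ M → MeasurableSet A → φ ⁻¹' A = A →
    (∃ u : X → ℝ, Measurable u ∧ ∀ x ∈ A, β * F x = u (φ x) - u x) → m A = 0

/-- `m` is of type `I_p`. -/
def IsTypeIp (φ : X ≃ X) (F : X → ℝ) (m : Measure X) (p : ℕ) : Prop :=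
  m (MIp φ F p) = 1

/-- `m` is of type `I_∞`. -/
def IsTypeIinf (φ : X ≃ X) (F : X → ℝ) (β : ℝ) (m : Measure X) : Prop :=
  m (MIinf φ F β) = 1

/-- `m` is of type `II_1`. -/
def IsTypeII1 (φ : X ≃ X) (F : X → ℝ) (β : ℝ) (m : Measure X) : Prop :=
  m (MII1 φ F β) = 1

/-- `m` is of type `II_∞`: it is concentrated on
`M_{II_∞} = X \ (M_I ∪ M_{II_1} ∪ M_{III})`. -/
def IsTypeIIinf (φ : X ≃ X) (F : X → ℝ) (β : ℝ) (m : Measure X) : Prop :=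
  ∃ M : Set X, IsMIII φ F β m M ∧ m (MI φ F β ∪ MII1 φ F β ∪ M)ᶜ = 1

/-- `m` is of type `III`. -/
def IsTypeIII (φ : X ≃ X) (F : X → ℝ) (β : ℝ) (m : Measure X) : Prop :=
  ∃ M : Set X, IsMIII φ F β m M ∧ m M = 1

/-- `m` is (purely) atomic: it is concentrated on a countable set. -/
def IsAtomic (m : Measure X) : Prop :=
  ∃ C : Set X, C.Countable ∧ m Cᶜ = 0

/-- Equivalence of measures: the same null sets. -/
def Equivalent (m ν : Measure X) : Prop :=
  m ≪ ν ∧ ν ≪ m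

end ConformalType

/-!
An atom `x` of an `e^{βF}`-conformal measure charges its orbit by `m {φ^k x} = e^{βS_k(x)} m {x}`,
which decides between `I_p` and `I_∞`. Conversely the points of `M_{I_∞}` at which the cocycle
attains its maximum over the orbit for the first time, and the points of `M_{I_p}` at which an
injection into `ℝ` is least on the orbit, form sets that meet no orbit twice; by ergodicity such a
set, if it is not null, contains an atom.

The measure with density `g` with respect to `m` is invariant if and only if
`e^{βF} · g ∘ φ = g` almost everywhere, so equivalent `σ`-finite invariant measures correspond to
almost everywhere defined solutions of `βF = u ∘ φ - u` through `g = e^{-u}`. This yields type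
`III`.

The function `D = liminf n⁻¹ ∑_{j=1}^n e^{βS_j}` satisfies `D ≤ e^{βF} · D ∘ φ`, and the two sides
have the same integral, which is at most `1` by Fatou's lemma. Hence `D` is the density of a finite
invariant measure, equivalent to `m` unless `D` vanishes almost everywhere. If there is an
equivalent finite invariant measure, with density `g`, then `e^{βS_j} = g / g ∘ φ^j`, and the
maximal ergodic theorem bounds the Birkhoff averages of `1 / g` away from zero, so that `D > 0`.
By ergodicity every density of a `σ`-finite invariant measure is a constant multiple of a positive
`D`, so `D` vanishes if there is an infinite such measure; this separates `II_1` from `II_∞`.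
-/

namespace ConformalType

section Cocycle

variable {X : Type*} (T : Equiv.Perm X) (F : X → ℝ)

@[simp]
lemma S_zero (x : X) : S T F 0 x = 0 := Finset.sum_range_zero _

lemma S_natCast (n : ℕ) (x : X) : S T F n x = ∑ j ∈ Finset.range n, F (T^[j] x) := rfl

lemma S_negSucc (n : ℕ) (x : X) :
    S T F (Int.negSucc n) x = -∑ j ∈ Finset.Icc 1 (n + 1), F ((T ^ (-j : ℤ)) x) := by
  simp only [zpow_neg, zpow_natCast, ← inv_pow, ← Equiv.Perm.iterate_eq_pow]
  rfl

lemma S_add_one (k : ℤ) (x : X) : S T F (k + 1) x = S T F k x + F ((T ^ k) x) := by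
  rcases k with n | _ | n
  · exact Finset.sum_range_succ _ _
  · rw [S_negSucc]
    change S T F 0 x = _
    simp
  · change S T F (Int.negSucc n) x = _
    rw [S_negSucc, S_negSucc, Finset.sum_Icc_succ_top (Nat.le_add_left 1 (n + 1)),
      Int.negSucc_eq]
    push_cast
    ring

@[simp]
lemma S_one (x : X) : S T F 1 x = F x := by
  simpa using S_add_one T F 0 x

lemma S_add (n k : ℤ) (x : X) : S T F (n + k) x = S T F k x + S T F n ((T ^ k) x) := by
  induction n using Int.induction_on with
  | zero => simp
  | succ n ih =>
    rw [add_right_comm, S_add_one, ih, S_add_one, zpow_add, Equiv.Perm.mul_apply, add_assoc]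
  | pred n ih =>
    have h₁ := S_add_one T F (-n - 1 + k) x
    have h₂ := S_add_one T F (-n - 1) ((T ^ k) x)
    rw [zpow_add, Equiv.Perm.mul_apply, add_right_comm, sub_add_cancel] at h₁
    rw [sub_add_cancel] at h₂
    linarith

lemma S_neg_zpow (k : ℤ) (x : X) : S T F (-k) ((T ^ k) x) = -S T F k x := by
  have h := S_add T F (-k) k x
  rw [neg_add_cancel, S_zero] at h
  linarith

/-- The Jacobian `e^{βS_k}` of `T ^ k` for an `e^{βF}`-conformal measure. -/
noncomputable def jacobian (β : ℝ) (k : ℤ) (x : X) : ℝ≥0∞ :=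
  ENNReal.ofReal (Real.exp (β * S T F k x))

variable (β : ℝ)

lemma jacobian_ne_zero (k : ℤ) (x : X) : jacobian T F β k x ≠ 0 := by
  simp [jacobian, Real.exp_pos]

lemma jacobian_ne_top (k : ℤ) (x : X) : jacobian T F β k x ≠ ∞ := ENNReal.ofReal_ne_top

@[simp]
lemma jacobian_zero (x : X) : jacobian T F β 0 x = 1 := by simp [jacobian]

lemma jacobian_one (x : X) : jacobian T F β 1 x = ENNReal.ofReal (Real.exp (β * F x)) := by
  simp [jacobian]

lemma jacobian_add (n k : ℤ) (x : X) :
    jacobian T F β (n + k) x = jacobian T F β k x * jacobian T F β n ((T ^ k) x) := by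
  simp only [jacobian]
  rw [S_add, mul_add, Real.exp_add, ENNReal.ofReal_mul (Real.exp_pos _).le]

lemma jacobian_add_one (n : ℤ) (x : X) :
    jacobian T F β (n + 1) x = jacobian T F β 1 x * jacobian T F β n (T x) := by
  rw [jacobian_add, zpow_one]

variable {T F β}

lemma mem_MIinf_iff {x : X} : x ∈ MIinf T F β ↔ ∑' k : ℤ, jacobian T F β k x ≠ ∞ := by
  refine ⟨Summable.tsum_ofReal_ne_top, fun h => (ENNReal.summable_toReal h).congr fun k => ?_⟩
  exact ENNReal.toReal_ofReal (Real.exp_pos _).le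

end Cocycle

section Orbits

variable {X : Type*} (T : Equiv.Perm X)

lemma mem_orbit_self (x : X) : x ∈ orbit T x := ⟨0, rfl⟩

lemma countable_orbit (x : X) : (orbit T x).Countable := Set.countable_range _

lemma preimage_orbit (x : X) : T ⁻¹' orbit T x = orbit T x := by
  ext y
  exact (Equiv.addLeft (-1 : ℤ)).exists_congr fun k => by simp [zpow_add, Equiv.symm_apply_eq]

/-- The smallest `T`-invariant set containing `W`. -/
def saturation (W : Set X) : Set X := ⋃ k : ℤ, (T ^ k) ⁻¹' W

variable {T}

lemma mem_saturation {W : Set X} {x : X} : x ∈ saturation T W ↔ ∃ k : ℤ, (T ^ k) x ∈ W := by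
  simp [saturation]

variable (T) in
lemma subset_saturation (W : Set X) : W ⊆ saturation T W :=
  fun _ hx => mem_saturation.2 ⟨0, hx⟩

variable (T) in
lemma preimage_saturation (W : Set X) : T ⁻¹' saturation T W = saturation T W := by
  ext y
  simp only [Set.mem_preimage, mem_saturation]
  exact (Equiv.addRight (1 : ℤ)).exists_congr fun k => by simp [zpow_add]

lemma zpow_eq_self_iff {x : X} {k : ℤ} :
    (T ^ k) x = x ↔ (Function.minimalPeriod T x : ℤ) ∣ k :=
  MulAction.zpow_smul_eq_iff_minimalPeriod_dvd (a := T) (b := x)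

lemma zpow_injective_of_notMem_periodicPts {x : X} (hx : x ∉ Function.periodicPts T) :
    Function.Injective fun k : ℤ => (T ^ k) x := by
  intro a b (hab : (T ^ a) x = (T ^ b) x)
  have h : (T ^ (-a + b)) x = x := by
    rw [zpow_add, Equiv.Perm.mul_apply, ← hab, zpow_neg]
    exact (T ^ a).symm_apply_apply x
  rw [zpow_eq_self_iff, Function.minimalPeriod_eq_zero_of_notMem_periodicPts hx] at h
  simp only [Nat.cast_zero, zero_dvd_iff] at h
  omega

lemma orbit_finite_iff {x : X} : (orbit T x).Finite ↔ x ∈ Function.periodicPts T := by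
  refine ⟨fun h => ?_, fun h => ?_⟩
  · contrapose! h
    exact Set.infinite_range_of_injective (zpow_injective_of_notMem_periodicPts h)
  · have hp : (0 : ℤ) < Function.minimalPeriod T x := by
      exact_mod_cast Function.minimalPeriod_pos_of_mem_periodicPts h
    refine ((Set.finite_Ico (0 : ℤ) (Function.minimalPeriod T x)).image
      fun k => (T ^ k) x).subset ?_
    rintro _ ⟨k, rfl⟩
    refine ⟨k % Function.minimalPeriod T x, ⟨Int.emod_nonneg _ hp.ne', Int.emod_lt_of_pos _ hp⟩, ?_⟩
    have hk : (T ^ (Function.minimalPeriod T x * (k / Function.minimalPeriod T x))) x = x :=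
      zpow_eq_self_iff.2 (dvd_mul_right _ _)
    conv_rhs => beta_reduce; rw [← Int.emod_add_mul_ediv k (Function.minimalPeriod T x)]
    rw [zpow_add, Equiv.Perm.mul_apply, hk]

variable (T) in
/-- The points at which `f` attains its minimum over the orbit; if `f` is injective, this set
meets every finite orbit in exactly one point. -/
def orbitMinima (f : X → ℝ) : Set X := {x | ∀ k : ℤ, f x ≤ f ((T ^ k) x)}

lemma zpow_eq_self_of_mem_orbitMinima {f : X → ℝ} (hf : Function.Injective f) {x : X} {k : ℤ}
    (hx : x ∈ orbitMinima T f) (hk : (T ^ k) x ∈ orbitMinima T f) : (T ^ k) x = x := by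
  have h := hk (-k)
  rw [← Equiv.Perm.mul_apply, ← zpow_add, neg_add_cancel, zpow_zero, Equiv.Perm.one_apply] at h
  exact hf (h.antisymm (hx k))

lemma periodicPts_subset_saturation_orbitMinima (f : X → ℝ) :
    Function.periodicPts T ⊆ saturation T (orbitMinima T f) := by
  intro x hx
  obtain ⟨_, ⟨k, rfl⟩, hk⟩ :=
    Set.exists_min_image _ f (orbit_finite_iff.2 hx) ⟨x, mem_orbit_self T x⟩
  refine mem_saturation.2 ⟨k, fun n => hk _ ⟨n + k, ?_⟩⟩
  simp [zpow_add]

end Orbits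

section TypeI

variable {X : Type*} {T : Equiv.Perm X} {F : X → ℝ} {β : ℝ}

lemma zpow_apply_comm (k l : ℤ) (x : X) : (T ^ k) ((T ^ l) x) = (T ^ l) ((T ^ k) x) := by
  rw [← Equiv.Perm.mul_apply, ← Equiv.Perm.mul_apply, zpow_mul_comm]

lemma zpow_mem_MIinf {x : X} (hx : x ∈ MIinf T F β) (k : ℤ) : (T ^ k) x ∈ MIinf T F β := by
  rw [mem_MIinf_iff, ← (Equiv.addRight k).tsum_eq] at hx
  simp only [Equiv.coe_addRight, jacobian_add, ENNReal.tsum_mul_left] at hx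
  exact mem_MIinf_iff.2 fun h => hx (by rw [h, ENNReal.mul_top (jacobian_ne_zero T F β k x)])

lemma sum_Icc_iterate_eq_S {x : X} {p : ℕ} (h : T^[p] x = x) :
    ∑ i ∈ Finset.Icc 1 p, F (T^[i] x) = S T F p x := by
  have h₁ := Finset.sum_range_succ (fun i => F (T^[i] x)) p
  rw [h, Finset.sum_range_succ', Function.iterate_zero_apply, add_left_inj] at h₁
  rw [S_natCast, ← h₁, Finset.range_eq_Ico, Finset.sum_Ico_add' (fun i => F (T^[i] x)) 0 p 1]
  rfl

lemma mem_MIp_iff {x : X} {p : ℕ} (hp : 1 ≤ p) :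
    x ∈ MIp T F p ↔ IsFCyclic T F x ∧ Function.minimalPeriod T x = p := by
  constructor
  · rintro ⟨hper, hmin, hS⟩
    have hper' : Function.IsPeriodicPt T p x := hper
    have hp' : Function.minimalPeriod T x = p :=
      (hper'.minimalPeriod_le hp).antisymm <| not_lt.1 fun hlt =>
        hmin _ (hper'.minimalPeriod_pos hp) hlt Function.iterate_minimalPeriod
    exact ⟨⟨⟨p, hp, hper⟩, by rw [hp', sum_Icc_iterate_eq_S hper, hS]⟩, hp'⟩
  · rintro ⟨⟨-, hS⟩, rfl⟩
    refine ⟨Function.iterate_minimalPeriod, fun j hj hlt hjx => ?_, ?_⟩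
    · exact hlt.not_ge (Function.IsPeriodicPt.minimalPeriod_le (f := T) hj hjx)
    · rw [← sum_Icc_iterate_eq_S Function.iterate_minimalPeriod, hS]

lemma zpow_mem_MIp {x : X} {p : ℕ} (hx : x ∈ MIp T F p) (k : ℤ) : (T ^ k) x ∈ MIp T F p := by
  obtain ⟨hper, hmin, hS⟩ := hx
  have hcomm (j : ℕ) : T^[j] ((T ^ k) x) = (T ^ k) (T^[j] x) := by
    simpa [Equiv.Perm.iterate_eq_pow] using zpow_apply_comm j k x
  refine ⟨by rw [hcomm, hper], fun j hj hlt hjx => hmin j hj hlt ?_, ?_⟩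
  · exact (T ^ k).injective (by rw [← hcomm, hjx])
  · have h₁ := S_add T F p k x
    rw [add_comm, S_add, zpow_natCast, ← Equiv.Perm.iterate_eq_pow, hper] at h₁
    linarith

variable (T F β) in
/-- The points at which the cocycle `k ↦ βS_k` attains its maximum over the orbit for the first
time. -/
def firstMaxima : Set X :=
  {x | (∀ n, β * S T F n x ≤ 0) ∧ ∀ n < 0, β * S T F n x < 0}

lemma eq_zero_of_zpow_mem_firstMaxima {x : X} {k : ℤ} (hx : x ∈ firstMaxima T F β)
    (hk : (T ^ k) x ∈ firstMaxima T F β) : k = 0 := by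
  have h := S_neg_zpow T F k x
  rcases lt_trichotomy k 0 with hneg | hzero | hpos
  · linarith [hx.2 k hneg, h ▸ hk.1 (-k)]
  · exact hzero
  · linarith [hx.1 k, h ▸ hk.2 (-k) (by omega)]

lemma MIinf_subset_saturation_firstMaxima :
    MIinf T F β ⊆ saturation T (firstMaxima T F β) := by
  intro x hx
  have hfin : {n : ℤ | 0 ≤ β * S T F n x}.Finite := by
    have h := (Summable.tendsto_cofinite_zero hx).eventually (gt_mem_nhds zero_lt_one)
    exact (eventually_cofinite.1 h).subset fun n hn => by simpa using hn
  obtain ⟨a, ha, hamax⟩ := Set.exists_max_image _ (fun n => β * S T F n x) hfin ⟨0, by simp⟩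
  have hmax (n : ℤ) : β * S T F n x ≤ β * S T F a x :=
    (le_total 0 (β * S T F n x)).elim (hamax n) fun hn => hn.trans ha
  obtain ⟨k, hk, hkmin⟩ := Set.exists_min_image {n | β * S T F n x = β * S T F a x} id
    (hfin.subset fun n (hn : _ = _) => ha.trans hn.ge) ⟨a, rfl⟩
  have hS (n : ℤ) : β * S T F n ((T ^ k) x) = β * S T F (n + k) x - β * S T F a x := by
    rw [S_add, ← show β * S T F k x = β * S T F a x from hk]
    ring
  refine mem_saturation.2 ⟨k, fun n => ?_, fun n hn => ?_⟩
  · rw [hS, sub_nonpos]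
    exact hmax _
  · rw [hS, sub_neg]
    refine (hmax _).lt_of_ne fun heq => ?_
    have : k ≤ n + k := hkmin _ heq
    omega

lemma notMem_periodicPts_of_mem_MIinf {x : X} (hx : x ∈ MIinf T F β) :
    x ∉ Function.periodicPts T := by
  rintro ⟨p, hp, hpx⟩
  obtain ⟨k, hk⟩ := mem_saturation.1 (MIinf_subset_saturation_firstMaxima hx)
  have hpk : (T ^ (p : ℤ)) ((T ^ k) x) = (T ^ k) x := by
    rw [zpow_apply_comm, zpow_natCast, ← Equiv.Perm.iterate_eq_pow, hpx.eq]
  have := eq_zero_of_zpow_mem_firstMaxima hk (k := p) (by rwa [hpk])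
  omega

end TypeI

section QuasiInvariant

variable {X : Type*} [MeasurableSpace X] {φ : X ≃ᵐ X} {m : Measure X}

lemma measurable_zpow (φ : X ≃ᵐ X) (k : ℤ) : Measurable ((φ.toEquiv : Equiv.Perm X) ^ k) := by
  induction k using Int.induction_on with
  | zero => exact measurable_id
  | succ n ih => rw [zpow_add_one]; exact ih.comp φ.measurable
  | pred n ih => rw [zpow_sub_one]; exact ih.comp φ.symm.measurable

lemma quasiMeasurePreserving_zpow (h : Measure.QuasiMeasurePreserving φ m m)
    (h' : Measure.QuasiMeasurePreserving φ.symm m m) (k : ℤ) :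
    Measure.QuasiMeasurePreserving ((φ.toEquiv : Equiv.Perm X) ^ k) m m := by
  induction k using Int.induction_on with
  | zero => exact .id m
  | succ n ih => rw [zpow_add_one]; exact ih.comp h
  | pred n ih => rw [zpow_sub_one]; exact ih.comp h'

lemma measurableSet_saturation (φ : X ≃ᵐ X) {W : Set X} (hW : MeasurableSet W) :
    MeasurableSet (saturation φ.toEquiv W) :=
  .iUnion fun k => measurable_zpow φ k hW

lemma measure_saturation_eq_zero (h : Measure.QuasiMeasurePreserving φ m m)
    (h' : Measure.QuasiMeasurePreserving φ.symm m m) {W : Set X} (hW : m W = 0) :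
    m (saturation φ.toEquiv W) = 0 :=
  measure_iUnion_null fun k => (quasiMeasurePreserving_zpow h h' k).preimage_null hW

lemma exists_invariant_subset (h : Measure.QuasiMeasurePreserving φ m m)
    (h' : Measure.QuasiMeasurePreserving φ.symm m m) {G : Set X} (hG : MeasurableSet G)
    (hG0 : m Gᶜ = 0) : ∃ A ⊆ G, MeasurableSet A ∧ φ ⁻¹' A = A ∧ m Aᶜ = 0 := by
  refine ⟨(saturation φ.toEquiv Gᶜ)ᶜ, Set.compl_subset_comm.1 (subset_saturation _ Gᶜ),
    (measurableSet_saturation φ hG.compl).compl, ?_, ?_⟩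
  · exact congrArg compl (preimage_saturation φ.toEquiv Gᶜ)
  · rw [compl_compl]
    exact measure_saturation_eq_zero h h' hG0

lemma measure_eq_zero_or_ae_mem_saturation (herg : PreErgodic φ m) {W : Set X}
    (hW : MeasurableSet W) : m W = 0 ∨ ∀ᵐ x ∂m, x ∈ saturation φ.toEquiv W :=
  (herg.measure_self_or_compl_eq_zero (measurableSet_saturation φ hW)
    (preimage_saturation φ.toEquiv W)).imp_left (measure_mono_null (subset_saturation _ W))

lemma absolutelyContinuous_of_invariant (herg : PreErgodic φ m) {ν : Measure X}
    (hν : MeasurePreserving φ ν ν) (hac : ν ≪ m) (hν0 : ν ≠ 0) : m ≪ ν := by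
  refine .mk fun B hB hB0 =>
    (measure_eq_zero_or_ae_mem_saturation herg hB).resolve_right fun h => ?_
  have hsat : ∀ᵐ x ∂ν, x ∉ saturation φ.toEquiv B := measure_eq_zero_iff_ae_notMem.1 <|
    measure_saturation_eq_zero hν.quasiMeasurePreserving hν.symm.quasiMeasurePreserving hB0
  have hsat' : ∀ᵐ x ∂ν, x ∈ saturation φ.toEquiv B := hac.ae_le h
  have : NeZero ν := ⟨hν0⟩
  obtain ⟨x, hx, hx'⟩ := (hsat'.and hsat).exists
  exact hx' hx

end QuasiInvariant

section CountablySeparated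

variable {X : Type*} [MeasurableSpace X] [MeasurableSpace.CountablySeparated X]

variable (X) in
lemma exists_measurable_injective_real : ∃ f : X → ℝ, Measurable f ∧ Function.Injective f := by
  obtain ⟨f, hf, hinj⟩ := MeasurableSpace.measurable_injection_nat_bool_of_countablySeparated X
  have he := measurableEmbedding_embeddingReal (ℕ → Bool)
  exact ⟨_, he.measurable.comp hf, he.injective.comp hinj⟩

variable {φ : X ≃ᵐ X} {m : Measure X}

lemma exists_measure_singleton_ne_zero (herg : PreErgodic φ m) {W : Set X}
    (hW : MeasurableSet W) (hW0 : m W ≠ 0)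
    (horbit : ∀ x ∈ W, ∀ k : ℤ, ((φ.toEquiv : Equiv.Perm X) ^ k) x ∈ W →
      ((φ.toEquiv : Equiv.Perm X) ^ k) x = x) :
    ∃ x ∈ W, m {x} ≠ 0 := by
  have hzero_one (U : Set X) (hU : MeasurableSet U) :
      (∀ᵐ x ∂m.restrict W, id x ∈ U) ∨ ∀ᵐ x ∂m.restrict W, id x ∉ U := by
    simp only [ae_restrict_iff' hW, id]
    refine (measure_eq_zero_or_ae_mem_saturation herg (hU.inter hW)).symm.imp ?_ ?_
    · refine fun h => h.mono fun x hx hxW => ?_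
      obtain ⟨k, hkU, hkW⟩ := mem_saturation.1 hx
      exact horbit x hxW k hkW ▸ hkU
    · exact fun h => (measure_eq_zero_iff_ae_notMem.1 h).mono fun x hx hxW hxU => hx ⟨hxU, hxW⟩
  have : HasCountableSeparatingOn X MeasurableSet W := .mono (fun _ => id) (Set.subset_univ W)
  obtain ⟨c, hcW, hc⟩ :=
    exists_mem_eventuallyEq_const_of_eventually_mem_of_forall_separating MeasurableSet
      (show ∀ᵐ x ∂m.restrict W, id x ∈ W from ae_restrict_mem hW)
      (nonempty_of_measure_ne_zero hW0) hzero_one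
  refine ⟨c, hcW, fun hc0 => hW0 ?_⟩
  rw [← Measure.restrict_eq_zero, ← ae_eq_bot, ← empty_mem_iff_bot]
  filter_upwards [hc, ae_restrict_of_ae (measure_eq_zero_iff_ae_notMem.1 hc0)] with x hx hx'
  exact hx' hx

lemma exists_measure_singleton_ne_zero_of_subset_saturation (herg : PreErgodic φ m)
    (h : Measure.QuasiMeasurePreserving φ m m) (h' : Measure.QuasiMeasurePreserving φ.symm m m)
    {A W : Set X} (hA : MeasurableSet A) (hW : MeasurableSet W) (hA0 : m A ≠ 0)
    (hAinv : ∀ x ∈ A, ∀ k : ℤ, ((φ.toEquiv : Equiv.Perm X) ^ k) x ∈ A)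
    (hAW : A ⊆ saturation φ.toEquiv W)
    (horbit : ∀ x ∈ W, ∀ k : ℤ, ((φ.toEquiv : Equiv.Perm X) ^ k) x ∈ W →
      ((φ.toEquiv : Equiv.Perm X) ^ k) x = x) :
    ∃ x ∈ A, m {x} ≠ 0 := by
  have hsub : A ⊆ saturation φ.toEquiv (A ∩ W) := fun x hx =>
    let ⟨k, hk⟩ := mem_saturation.1 (hAW hx)
    mem_saturation.2 ⟨k, hAinv x hx k, hk⟩
  have hAW0 : m (A ∩ W) ≠ 0 := fun h0 =>
    hA0 (measure_mono_null hsub (measure_saturation_eq_zero h h' h0))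
  obtain ⟨x, hx, hx0⟩ := exists_measure_singleton_ne_zero herg (hA.inter hW) hAW0
    fun x hx k hk => horbit x hx.2 k hk.2
  exact ⟨x, hx.1, hx0⟩

end CountablySeparated

lemma measure_orbit_eq_one {X : Type*} [MeasurableSpace X] [MeasurableSingletonClass X]
    {φ : X ≃ᵐ X} {m : Measure X} [IsProbabilityMeasure m] (herg : PreErgodic φ m) {x : X}
    (hx : m {x} ≠ 0) : m (orbit φ.toEquiv x) = 1 :=
  (herg.prob_eq_zero_or_one (countable_orbit _ x).measurableSet
    (preimage_orbit φ.toEquiv x)).resolve_left fun h =>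
      hx (measure_mono_null (Set.singleton_subset_iff.2 (mem_orbit_self _ x)) h)

section MaximalErgodic

variable {X : Type*} {T : X → X} {g : X → ℝ}

/-- The maximum of the Birkhoff sums of `g` of length at most `N`; it is nonnegative since the
empty sum is included. -/
noncomputable def maxBirkhoffSum (T : X → X) (g : X → ℝ) (N : ℕ) (x : X) : ℝ :=
  partialSups (fun n => birkhoffSum T g n x) N

lemma maxBirkhoffSum_add_one (N : ℕ) :
    maxBirkhoffSum T g (N + 1) = maxBirkhoffSum T g N ⊔ birkhoffSum T g (N + 1) :=
  funext fun x => partialSups_succ (fun n => birkhoffSum T g n x) N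

lemma birkhoffSum_le_maxBirkhoffSum {n N : ℕ} (h : n ≤ N) (x : X) :
    birkhoffSum T g n x ≤ maxBirkhoffSum T g N x :=
  le_partialSups_of_le (fun n => birkhoffSum T g n x) h

lemma maxBirkhoffSum_nonneg (N : ℕ) (x : X) : 0 ≤ maxBirkhoffSum T g N x :=
  birkhoffSum_le_maxBirkhoffSum (T := T) (g := g) N.zero_le x

lemma maxBirkhoffSum_pos_iff {N : ℕ} {x : X} :
    0 < maxBirkhoffSum T g N x ↔ ∃ n ≤ N, 0 < birkhoffSum T g n x := by
  refine ⟨fun h => ?_, fun ⟨n, hn, h⟩ => h.trans_le (birkhoffSum_le_maxBirkhoffSum hn x)⟩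
  obtain ⟨n, hn, hmax⟩ := exists_partialSups_eq (fun n => birkhoffSum T g n x) N
  exact ⟨n, hn, hmax ▸ h⟩

lemma maxBirkhoffSum_sub_le {N : ℕ} {x : X} (h : 0 < maxBirkhoffSum T g N x) :
    maxBirkhoffSum T g N x - maxBirkhoffSum T g N (T x) ≤ g x := by
  obtain ⟨_ | n, hn, hmax⟩ := exists_partialSups_eq (fun n => birkhoffSum T g n x) N
  · exact absurd (hmax.trans (birkhoffSum_zero T g x)) h.ne'
  · have hle := birkhoffSum_le_maxBirkhoffSum (T := T) (g := g) (n.le_succ.trans hn) (T x)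
    have hx : maxBirkhoffSum T g N x = g x + birkhoffSum T g n (T x) := by
      rw [← birkhoffSum_succ']
      exact hmax
    linarith

variable [MeasurableSpace X] {ν : Measure X}

lemma measurable_birkhoffSum (hT : Measurable T) (hg : Measurable g) (n : ℕ) :
    Measurable (birkhoffSum T g n) :=
  Finset.measurable_sum _ fun j _ => hg.comp (hT.iterate j)

lemma measurable_maxBirkhoffSum (hT : Measurable T) (hg : Measurable g) (N : ℕ) :
    Measurable (maxBirkhoffSum T g N) := by
  induction N with
  | zero => exact measurable_zero
  | succ N ih => exact maxBirkhoffSum_add_one (T := T) N ▸ ih.sup (measurable_birkhoffSum hT hg _)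

lemma integrable_maxBirkhoffSum (hT : MeasurePreserving T ν ν) (hg : Integrable g ν) (N : ℕ) :
    Integrable (maxBirkhoffSum T g N) ν := by
  induction N with
  | zero => exact integrable_zero X ℝ ν
  | succ N ih =>
    rw [maxBirkhoffSum_add_one]
    exact ih.sup <| integrable_finsetSum _ fun j _ =>
      (hT.iterate j).integrable_comp_of_integrable hg

lemma setIntegral_maxBirkhoffSum_pos_nonneg (hT : MeasurePreserving T ν ν) (hg : Measurable g)
    (hgi : Integrable g ν) (N : ℕ) :
    0 ≤ ∫ x in {x | 0 < maxBirkhoffSum T g N x}, g x ∂ν := by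
  set M := maxBirkhoffSum T g N
  set E := {x | 0 < M x}
  have hM : Measurable M := measurable_maxBirkhoffSum hT.measurable hg N
  have hMi : Integrable M ν := integrable_maxBirkhoffSum hT hgi N
  have hMTi : Integrable (M ∘ T) ν := hT.integrable_comp_of_integrable hMi
  have hE : MeasurableSet E := measurableSet_lt measurable_const hM
  have hME : ∫ x in E, M x ∂ν = ∫ x, M x ∂ν :=
    setIntegral_eq_integral_of_forall_compl_eq_zero fun x hx =>
      (not_lt.1 hx).antisymm (maxBirkhoffSum_nonneg N x)
  have hMTE : ∫ x in E, M (T x) ∂ν ≤ ∫ x, M (T x) ∂ν :=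
    setIntegral_le_integral hMTi (ae_of_all _ fun x => maxBirkhoffSum_nonneg N (T x))
  have hMT : ∫ x, M (T x) ∂ν = ∫ x, M x ∂ν := by
    rw [← integral_map hT.aemeasurable hM.aestronglyMeasurable, hT.map_eq]
  calc 0 ≤ ∫ x in E, M x ∂ν - ∫ x in E, M (T x) ∂ν := by linarith
    _ = ∫ x in E, (M x - M (T x)) ∂ν :=
      (integral_sub hMi.integrableOn hMTi.integrableOn).symm
    _ ≤ ∫ x in E, g x ∂ν :=
      setIntegral_mono_on (hMi.sub hMTi).integrableOn hgi.integrableOn hE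
        fun x hx => maxBirkhoffSum_sub_le hx

lemma mul_measure_exists_birkhoffSum_gt_le [IsFiniteMeasure ν] (hT : MeasurePreserving T ν ν)
    {f : X → ℝ} (hf : Measurable f) (hf0 : 0 ≤ f) (hfi : Integrable f ν) (a : ℝ) :
    ENNReal.ofReal a * ν {x | ∃ n : ℕ, n * a < birkhoffSum T f n x} ≤
      ∫⁻ x, ENNReal.ofReal (f x) ∂ν := by
  set E : ℕ → Set X := fun N => {x | 0 < maxBirkhoffSum T (fun x => f x - a) N x} with hE
  have hunion : {x | ∃ n : ℕ, n * a < birkhoffSum T f n x} = ⋃ N, E N := by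
    ext x
    have hsum (n : ℕ) : birkhoffSum T (fun x => f x - a) n x = birkhoffSum T f n x - n * a := by
      simp [birkhoffSum, Finset.sum_sub_distrib]
    simp only [hE, Set.mem_iUnion, Set.mem_ofPred_eq, maxBirkhoffSum_pos_iff, hsum, sub_pos]
    exact ⟨fun ⟨n, h⟩ => ⟨n, n, le_rfl, h⟩, fun ⟨_, n, _, h⟩ => ⟨n, h⟩⟩
  have hmono : Monotone E := fun M N hMN x hx => by
    obtain ⟨n, hn, h⟩ := maxBirkhoffSum_pos_iff.1 hx
    exact maxBirkhoffSum_pos_iff.2 ⟨n, hn.trans hMN, h⟩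
  rw [hunion, hmono.measure_iUnion, ENNReal.mul_iSup]
  refine iSup_le fun N => ?_
  have hmax := setIntegral_maxBirkhoffSum_pos_nonneg hT (hf.sub_const a)
    (hfi.sub (integrable_const a)) N
  rw [integral_sub hfi.integrableOn (integrable_const a), setIntegral_const, smul_eq_mul,
    sub_nonneg] at hmax
  calc ENNReal.ofReal a * ν (E N) = ENNReal.ofReal (ν.real (E N) * a) := by
        rw [ENNReal.ofReal_mul measureReal_nonneg, ofReal_measureReal, mul_comm]
    _ ≤ ENNReal.ofReal (∫ x, f x ∂ν) :=
        ENNReal.ofReal_le_ofReal (hmax.trans (setIntegral_le_integral hfi (ae_of_all _ hf0)))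
    _ = ∫⁻ x, ENNReal.ofReal (f x) ∂ν := ofReal_integral_eq_lintegral_ofReal hfi (ae_of_all _ hf0)

lemma tendsto_measure_lt_one_div [IsFiniteMeasure ν] (hg : Measurable g)
    (hpos : ∀ᵐ x ∂ν, 0 < g x) :
    Tendsto (fun k : ℕ => ν {x | g x < 1 / ((k : ℝ) + 1)}) atTop (nhds 0) := by
  have hnull : ν (⋂ k : ℕ, {x | g x < 1 / ((k : ℝ) + 1)}) = 0 := by
    refine measure_eq_zero_iff_ae_notMem.2 (hpos.mono fun x hx0 hx => ?_)
    obtain ⟨k, hk⟩ := exists_nat_one_div_lt hx0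
    exact hk.asymm (Set.mem_iInter.1 hx k)
  rw [← hnull]
  refine tendsto_measure_iInter_atTop
    (fun k => (measurableSet_lt hg measurable_const).nullMeasurableSet) (fun k l hkl x hx => ?_)
    ⟨0, measure_ne_top ν _⟩
  exact (show g x < _ from hx).trans_le (Nat.one_div_le_one_div hkl)

lemma ae_exists_birkhoffSum_indicator_le [IsFiniteMeasure ν] (hT : MeasurePreserving T ν ν)
    (hg : Measurable g) (hpos : ∀ᵐ x ∂ν, 0 < g x) :
    ∀ᵐ x ∂ν, ∃ δ > 0, ∀ n : ℕ,
      birkhoffSum T ({y | g y < δ}.indicator 1) n x ≤ n * (1 / 2 : ℝ) := by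
  set B : ℕ → Set X := fun k => {x | g x < 1 / ((k : ℝ) + 1)}
  have hB (k : ℕ) : MeasurableSet (B k) := measurableSet_lt hg measurable_const
  set E : ℕ → Set X := fun k =>
    {x | ∃ n : ℕ, (n * (1 / 2) : ℝ) < birkhoffSum T ((B k).indicator 1) n x}
  have hE (k : ℕ) : ENNReal.ofReal (1 / 2) * ν (E k) ≤ ν (B k) := by
    refine (mul_measure_exists_birkhoffSum_gt_le hT (measurable_one.indicator (hB k))
      (Set.indicator_nonneg fun _ _ => zero_le_one)
      ((integrable_const 1).indicator (hB k)) (1 / 2)).trans_eq ?_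
    rw [← lintegral_indicator_one (hB k)]
    refine lintegral_congr fun x => ?_
    by_cases hx : x ∈ B k <;> simp [hx]
  have hEinter : ν (⋂ k, E k) = 0 := by
    have hle (k : ℕ) : ENNReal.ofReal (1 / 2) * ν (⋂ k, E k) ≤ ν (B k) :=
      (mul_le_mul_right (measure_mono (Set.iInter_subset E k)) _).trans (hE k)
    have h0 := le_antisymm
      (ge_of_tendsto' (tendsto_measure_lt_one_div hg hpos) hle) zero_le
    exact (mul_eq_zero.1 h0).resolve_left (by simp)
  filter_upwards [measure_eq_zero_iff_ae_notMem.1 hEinter] with x hx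
  obtain ⟨k, hk⟩ : ∃ k, x ∉ E k := by simpa using hx
  exact ⟨1 / ((k : ℝ) + 1), by positivity, fun n => not_lt.1 fun h => hk ⟨n, h⟩⟩

lemma ae_exists_pos_mul_le_birkhoffSum [IsFiniteMeasure ν] (hT : MeasurePreserving T ν ν)
    (hg : Measurable g) (hpos : ∀ᵐ x ∂ν, 0 < g x) :
    ∀ᵐ x ∂ν, ∃ c > 0, ∀ n : ℕ, c * n ≤ birkhoffSum T g n x := by
  have horbit : ∀ᵐ x ∂ν, ∀ j : ℕ, 0 < g (T^[j] x) :=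
    ae_all_iff.2 fun j => (hT.iterate j).quasiMeasurePreserving.ae hpos
  filter_upwards [ae_exists_birkhoffSum_indicator_le hT hg hpos, horbit] with x ⟨δ, hδ, hx⟩ hgx
  set B : Set X := {y | g y < δ}
  have hterm (j : ℕ) : δ * (1 - B.indicator 1 (T^[j] x)) ≤ g (T^[j] x) := by
    by_cases hj : T^[j] x ∈ B
    · simpa [hj] using (hgx j).le
    · simpa only [Set.indicator_of_notMem hj, sub_zero, mul_one] using not_lt.1 hj
  refine ⟨δ / 2, by positivity, fun n => ?_⟩
  calc δ / 2 * n = δ * (n - n * (1 / 2)) := by ring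
    _ ≤ δ * (n - birkhoffSum T (B.indicator 1) n x) := by
        gcongr
        exact hx n
    _ = ∑ j ∈ Finset.range n, δ * (1 - B.indicator 1 (T^[j] x)) := by
        simp [← Finset.mul_sum, Finset.sum_sub_distrib, birkhoffSum]
    _ ≤ birkhoffSum T g n x := Finset.sum_le_sum fun j _ => hterm j

end MaximalErgodic

section Measurability

variable {X : Type*} [MeasurableSpace X] {F : X → ℝ}

lemma measurable_S (φ : X ≃ᵐ X) (hF : Measurable F) (k : ℤ) :
    Measurable (S φ.toEquiv F k) := by
  cases k with
  | ofNat n => exact Finset.measurable_sum _ fun j _ => hF.comp (φ.measurable.iterate j)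
  | negSucc n =>
    exact (Finset.measurable_sum _ fun j _ => hF.comp (φ.symm.measurable.iterate j)).neg

lemma measurable_jacobian (φ : X ≃ᵐ X) (hF : Measurable F) (β : ℝ) (k : ℤ) :
    Measurable (jacobian φ.toEquiv F β k) :=
  (Real.measurable_exp.comp ((measurable_S φ hF k).const_mul β)).ennreal_ofReal

lemma measurableSet_MIinf (φ : X ≃ᵐ X) (hF : Measurable F) (β : ℝ) :
    MeasurableSet (MIinf φ.toEquiv F β) := by
  rw [show MIinf φ.toEquiv F β = {x | ∑' k : ℤ, jacobian φ.toEquiv F β k x = ∞}ᶜ from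
    Set.ext fun x => mem_MIinf_iff]
  exact (measurableSet_eq_fun (.tsum fun k => measurable_jacobian φ hF β k) measurable_const).compl

lemma measurableSet_firstMaxima (φ : X ≃ᵐ X) (hF : Measurable F) (β : ℝ) :
    MeasurableSet (firstMaxima φ.toEquiv F β) := by
  have hS (k : ℤ) := (measurable_S φ hF k).const_mul β
  simp only [firstMaxima, Set.ofPred_and, Set.ofPred_forall]
  exact (MeasurableSet.iInter fun k => measurableSet_le (hS k) measurable_const).inter
    (.iInter fun k => .iInter fun _ => measurableSet_lt (hS k) measurable_const)

lemma measurableSet_orbitMinima (φ : X ≃ᵐ X) {f : X → ℝ} (hf : Measurable f) :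
    MeasurableSet (orbitMinima φ.toEquiv f) := by
  simp only [orbitMinima, Set.ofPred_forall]
  exact .iInter fun k => measurableSet_le hf (hf.comp (measurable_zpow φ k))

variable [MeasurableSpace.CountablySeparated X]

lemma measurableSet_isPeriodicPt (φ : X ≃ᵐ X) (j : ℕ) : MeasurableSet {x | φ^[j] x = x} := by
  obtain ⟨f, hf, hinj⟩ := exists_measurable_injective_real X
  simp_rw [← hinj.eq_iff]
  exact measurableSet_eq_fun (hf.comp (φ.measurable.iterate j)) hf

lemma measurableSet_MIp (φ : X ≃ᵐ X) (hF : Measurable F) (p : ℕ) :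
    MeasurableSet (MIp φ.toEquiv F p) := by
  simp only [MIp, Set.ofPred_and, Set.ofPred_forall]
  exact (measurableSet_isPeriodicPt φ p).inter <| .inter
    (.iInter fun j => .iInter fun _ => .iInter fun _ => (measurableSet_isPeriodicPt φ j).compl)
    (measurableSet_eq_fun (measurable_S φ hF p) measurable_const)

lemma measurableSet_MI (φ : X ≃ᵐ X) (hF : Measurable F) (β : ℝ) :
    MeasurableSet (MI φ.toEquiv F β) :=
  (measurableSet_MIinf φ hF β).union
    (.biUnion (Set.to_countable _) fun p _ => measurableSet_MIp φ hF p)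

end Measurability

namespace IsConformal

variable {X : Type*} [MeasurableSpace X] {φ : X ≃ᵐ X} {F : X → ℝ} {β : ℝ} {m : Measure X}

lemma map_symm (hm : IsConformal φ.toEquiv F β m) :
    m.map φ.symm = m.withDensity (jacobian φ.toEquiv F β 1) := by
  ext B hB
  rw [Measure.map_apply φ.symm.measurable hB, withDensity_apply _ hB]
  simp only [jacobian_one]
  rw [← hm.map_image B hB, Equiv.image_eq_preimage_symm]
  rfl

lemma quasiMeasurePreserving_symm (hm : IsConformal φ.toEquiv F β m) :
    Measure.QuasiMeasurePreserving φ.symm m m :=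
  ⟨φ.symm.measurable, hm.map_symm ▸ withDensity_absolutelyContinuous _ _⟩

lemma quasiMeasurePreserving (hm : IsConformal φ.toEquiv F β m) (hF : Measurable F) :
    Measure.QuasiMeasurePreserving φ m m := by
  refine ⟨φ.measurable, ?_⟩
  have h : m ≪ m.map φ.symm := by
    rw [hm.map_symm]
    exact withDensity_absolutelyContinuous' (measurable_jacobian φ hF β 1).aemeasurable
      (ae_of_all _ (jacobian_ne_zero φ.toEquiv F β 1))
  simpa [Measure.map_map φ.measurable φ.symm.measurable] using h.map φ.measurable

lemma quasiErgodic (hm : IsConformal φ.toEquiv F β m) (hF : Measurable F)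
    (herg : PreErgodic φ m) : QuasiErgodic φ m :=
  { hm.quasiMeasurePreserving hF, herg with }

lemma lintegral_jacobian_one_mul (hm : IsConformal φ.toEquiv F β m) (hF : Measurable F)
    {g : X → ℝ≥0∞} (hg : Measurable g) :
    ∫⁻ x, jacobian φ.toEquiv F β 1 x * g (φ x) ∂m = ∫⁻ x, g x ∂m := by
  have h := lintegral_withDensity_eq_lintegral_mul m (measurable_jacobian φ hF β 1)
    (hg.comp φ.measurable)
  rw [← hm.map_symm, lintegral_map (hg.comp φ.measurable) φ.symm.measurable] at h
  simpa using h.symm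

lemma lintegral_jacobian (hm : IsConformal φ.toEquiv F β m) (hF : Measurable F) (n : ℕ) :
    ∫⁻ x, jacobian φ.toEquiv F β n x ∂m = 1 := by
  induction n with
  | zero => have := hm.prob; simp
  | succ n ih =>
    rw [← ih, ← hm.lintegral_jacobian_one_mul hF (measurable_jacobian φ hF β n), Nat.cast_succ]
    exact lintegral_congr fun x => jacobian_add_one φ.toEquiv F β n x

section Atoms

variable [MeasurableSingletonClass X]

lemma measure_singleton_apply (hm : IsConformal φ.toEquiv F β m) (x : X) :
    m {φ x} = jacobian φ.toEquiv F β 1 x * m {x} := by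
  have h := hm.map_image {x} (measurableSet_singleton x)
  rwa [Set.image_singleton, lintegral_singleton, ← jacobian_one φ.toEquiv] at h

lemma measure_singleton_zpow (hm : IsConformal φ.toEquiv F β m) (k : ℤ) (x : X) :
    m {((φ.toEquiv : Equiv.Perm X) ^ k) x} = jacobian φ.toEquiv F β k x * m {x} := by
  have hstep (k : ℤ) : m {((φ.toEquiv : Equiv.Perm X) ^ (1 + k)) x} =
      jacobian φ.toEquiv F β 1 (((φ.toEquiv : Equiv.Perm X) ^ k) x) *
        m {((φ.toEquiv : Equiv.Perm X) ^ k) x} := by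
    rw [zpow_add, zpow_one]
    exact hm.measure_singleton_apply _
  induction k using Int.induction_on with
  | zero => simp
  | succ n ih => rw [add_comm, hstep, ih, jacobian_add, ← mul_assoc, mul_comm (jacobian _ _ _ 1 _)]
  | pred n ih =>
    have h := hstep (-n - 1)
    rw [add_sub_cancel, ih, ← add_sub_cancel 1 (-n : ℤ), jacobian_add, add_sub_cancel,
      mul_comm (jacobian _ _ _ _ x), mul_assoc] at h
    exact ((ENNReal.mul_right_inj (jacobian_ne_zero _ _ _ _ _)
      (jacobian_ne_top _ _ _ _ _)).1 h).symm

lemma mem_MIinf_of_orbit_infinite (hm : IsConformal φ.toEquiv F β m) {x : X} (hx : m {x} ≠ 0)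
    (hinf : (orbit φ.toEquiv x).Infinite) : x ∈ MIinf φ.toEquiv F β := by
  have := hm.prob
  have hinj := zpow_injective_of_notMem_periodicPts (mt orbit_finite_iff.2 hinf)
  have hsum : ∑' k : ℤ, m {((φ.toEquiv : Equiv.Perm X) ^ k) x} ≠ ∞ := by
    rw [← measure_iUnion (fun i j hij => Set.disjoint_singleton.2 (hinj.ne hij))
      fun _ => measurableSet_singleton _]
    exact measure_ne_top _ _
  simp only [hm.measure_singleton_zpow, ENNReal.tsum_mul_right] at hsum
  exact mem_MIinf_iff.2 fun h => hsum (by rw [h, ENNReal.top_mul hx])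

lemma mul_S_eq_zero (hm : IsConformal φ.toEquiv F β m) {x : X} (hx : m {x} ≠ 0) {p : ℕ}
    (hp : φ^[p] x = x) : β * S φ.toEquiv F p x = 0 := by
  have := hm.prob
  have h := hm.measure_singleton_zpow p x
  rw [zpow_natCast, ← Equiv.Perm.iterate_eq_pow, show φ.toEquiv^[p] x = x from hp, eq_comm,
    ENNReal.mul_eq_right hx (measure_ne_top m {x}), jacobian, ENNReal.ofReal_eq_one,
    Real.exp_eq_one_iff] at h
  exact h

end Atoms

variable [MeasurableSpace.CountablySeparated X]

lemma exists_measure_singleton_ne_zero_of_MIinf (hm : IsConformal φ.toEquiv F β m)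
    (hF : Measurable F) (herg : PreErgodic φ m) (h : m (MIinf φ.toEquiv F β) ≠ 0) :
    ∃ x ∈ MIinf φ.toEquiv F β, m {x} ≠ 0 :=
  exists_measure_singleton_ne_zero_of_subset_saturation herg (hm.quasiMeasurePreserving hF)
    hm.quasiMeasurePreserving_symm (measurableSet_MIinf φ hF β) (measurableSet_firstMaxima φ hF β)
    h (fun _ => zpow_mem_MIinf) MIinf_subset_saturation_firstMaxima fun x hx k hk => by
      rw [eq_zero_of_zpow_mem_firstMaxima hx hk, zpow_zero, Equiv.Perm.one_apply]

lemma exists_measure_singleton_ne_zero_of_MIp (hm : IsConformal φ.toEquiv F β m)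
    (hF : Measurable F) (herg : PreErgodic φ m) {p : ℕ} (hp : 1 ≤ p)
    (h : m (MIp φ.toEquiv F p) ≠ 0) : ∃ x ∈ MIp φ.toEquiv F p, m {x} ≠ 0 := by
  obtain ⟨f, hf, hinj⟩ := exists_measurable_injective_real X
  exact exists_measure_singleton_ne_zero_of_subset_saturation herg (hm.quasiMeasurePreserving hF)
    hm.quasiMeasurePreserving_symm (measurableSet_MIp φ hF p) (measurableSet_orbitMinima φ hf)
    h (fun _ => zpow_mem_MIp)
    (fun x hx => periodicPts_subset_saturation_orbitMinima f ((mem_MIp_iff hp).1 hx).1.1)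
    fun x hx k hk => zpow_eq_self_of_mem_orbitMinima hinj hx hk

lemma measure_MI_eq_zero [NullSingletonClass m] (hm : IsConformal φ.toEquiv F β m)
    (hF : Measurable F) (herg : PreErgodic φ m) : m (MI φ.toEquiv F β) = 0 := by
  refine measure_union_null ?_ ((measure_biUnion_null_iff (Set.to_countable _)).2 fun p hp => ?_)
  · by_contra h
    obtain ⟨x, -, hx⟩ := hm.exists_measure_singleton_ne_zero_of_MIinf hF herg h
    exact hx (measure_singleton x)
  · by_contra h
    obtain ⟨x, -, hx⟩ := hm.exists_measure_singleton_ne_zero_of_MIp hF herg hp h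
    exact hx (measure_singleton x)

end IsConformal

section TypeIMeasures

variable {X : Type*} [MeasurableSpace X] [MeasurableSingletonClass X] {φ : X ≃ᵐ X} {F : X → ℝ}
  {β : ℝ} {m : Measure X}

namespace IsConformal

lemma mem_MI_or_not_isFCyclic (hm : IsConformal φ.toEquiv F β m) {x : X} (hx : m {x} ≠ 0) :
    x ∈ MI φ.toEquiv F β ∨
      (β = 0 ∧ x ∈ Function.periodicPts φ.toEquiv ∧ ¬ IsFCyclic φ.toEquiv F x) := by
  by_cases hper : x ∈ Function.periodicPts φ.toEquiv
  · by_cases hcyc : IsFCyclic φ.toEquiv F x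
    · have hpos := Function.minimalPeriod_pos_of_mem_periodicPts hper
      refine .inl (.inr (Set.mem_biUnion (show _ ∈ Set.Ici 1 from hpos) ?_))
      exact (mem_MIp_iff hpos).2 ⟨hcyc, rfl⟩
    · have hit : φ.toEquiv^[Function.minimalPeriod φ.toEquiv x] x = x :=
        Function.iterate_minimalPeriod
      refine .inr ⟨(mul_eq_zero.1 (hm.mul_S_eq_zero hx hit)).resolve_right fun h => ?_, hper, hcyc⟩
      exact hcyc ⟨hper, by rw [sum_Icc_iterate_eq_S hit, h]⟩
  · exact .inl (.inl (hm.mem_MIinf_of_orbit_infinite hx (mt orbit_finite_iff.1 hper)))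

lemma measure_singleton_ne_zero_of_orbit (hm : IsConformal φ.toEquiv F β m) {x : X}
    (hx : m (orbit φ.toEquiv x) ≠ 0) : m {x} ≠ 0 := by
  refine fun h => hx ((measure_null_iff_singleton (countable_orbit _ x)).2 ?_)
  rintro _ ⟨k, rfl⟩
  exact (hm.measure_singleton_zpow k x).trans (by rw [h, mul_zero])

end IsConformal

lemma isAtomic_of_orbit [IsProbabilityMeasure m] {x : X} (hx : m (orbit φ.toEquiv x) = 1) :
    IsAtomic m :=
  ⟨_, countable_orbit _ x, (prob_compl_eq_zero_iff (countable_orbit _ x).measurableSet).2 hx⟩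

end TypeIMeasures

section InvariantDensities

variable {X : Type*} [MeasurableSpace X] {φ : X ≃ᵐ X} {F : X → ℝ} {β : ℝ} {m : Measure X}
  {f g : X → ℝ≥0∞}

/-- `g` solves almost everywhere the equation that characterizes the densities of invariant
measures with respect to the `e^{βF}`-conformal measure `m`. -/
structure IsInvariantDensity (φ : X ≃ᵐ X) (F : X → ℝ) (β : ℝ) (m : Measure X)
    (g : X → ℝ≥0∞) : Prop where
  measurable : Measurable g
  ae_mul_eq : ∀ᵐ x ∂m, jacobian φ.toEquiv F β 1 x * g (φ x) = g x

lemma equivalent_withDensity (hg : Measurable g) (hg0 : ∀ᵐ x ∂m, g x ≠ 0) :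
    Equivalent m (m.withDensity g) :=
  ⟨withDensity_absolutelyContinuous' hg.aemeasurable hg0, withDensity_absolutelyContinuous _ _⟩

namespace IsConformal

lemma map_symm_withDensity (hm : IsConformal φ.toEquiv F β m) (hF : Measurable F)
    (hg : Measurable g) :
    (m.withDensity g).map φ.symm =
      m.withDensity fun x => jacobian φ.toEquiv F β 1 x * g (φ x) := by
  ext B hB
  have hB' : MeasurableSet (φ.symm ⁻¹' B) := φ.symm.measurable hB
  rw [Measure.map_apply φ.symm.measurable hB, withDensity_apply _ hB', withDensity_apply _ hB,
    ← lintegral_indicator hB', ← lintegral_indicator hB,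
    ← hm.lintegral_jacobian_one_mul hF (hg.indicator hB')]
  refine lintegral_congr fun x => ?_
  by_cases hx : x ∈ B <;> simp [hx]

lemma measurePreserving_withDensity_iff (hm : IsConformal φ.toEquiv F β m) (hF : Measurable F)
    (hg : Measurable g) :
    MeasurePreserving φ (m.withDensity g) (m.withDensity g) ↔ IsInvariantDensity φ F β m g := by
  have := hm.prob
  have hJg : Measurable fun x => jacobian φ.toEquiv F β 1 x * g (φ x) :=
    (measurable_jacobian φ hF β 1).mul (hg.comp φ.measurable)
  calc MeasurePreserving φ (m.withDensity g) (m.withDensity g)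
      ↔ (m.withDensity g).map φ.symm = m.withDensity g :=
        ⟨fun h => (h.symm φ).map_eq, fun h => MeasurePreserving.symm φ.symm ⟨φ.symm.measurable, h⟩⟩
    _ ↔ ∀ᵐ x ∂m, jacobian φ.toEquiv F β 1 x * g (φ x) = g x := by
        rw [hm.map_symm_withDensity hF hg,
          withDensity_eq_iff_of_sigmaFinite hJg.aemeasurable hg.aemeasurable, EventuallyEq]
    _ ↔ IsInvariantDensity φ F β m g := ⟨fun h => ⟨hg, h⟩, fun h => h.ae_mul_eq⟩

lemma isInvariantDensity_rnDeriv (hm : IsConformal φ.toEquiv F β m) (hF : Measurable F)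
    {ν : Measure X} [SigmaFinite ν] (hν : MeasurePreserving φ ν ν) (hac : ν ≪ m) :
    IsInvariantDensity φ F β m (ν.rnDeriv m) := by
  have := hm.prob
  rw [← hm.measurePreserving_withDensity_iff hF (Measure.measurable_rnDeriv ν m),
    Measure.withDensity_rnDeriv_eq ν m hac]
  exact hν

end IsConformal

namespace IsInvariantDensity

lemma ae_jacobian_mul_iterate (hg : IsInvariantDensity φ F β m g)
    (h : Measure.QuasiMeasurePreserving φ m m) :
    ∀ᵐ x ∂m, ∀ n : ℕ, jacobian φ.toEquiv F β n x * g (φ^[n] x) = g x := by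
  refine ae_all_iff.2 fun n => ?_
  induction n with
  | zero => simp
  | succ n ih =>
    filter_upwards [hg.ae_mul_eq, h.ae ih] with x hx hφx
    rw [Nat.cast_succ, jacobian_add_one, mul_assoc, Function.iterate_succ_apply]
    exact (congrArg _ hφx).trans hx

lemma exists_ae_eq_const_mul [NeZero m] (herg : QuasiErgodic φ m)
    (hf : IsInvariantDensity φ F β m f) (hg : IsInvariantDensity φ F β m g)
    (hf' : ∀ᵐ x ∂m, f x < ∞) (hg' : ∀ᵐ x ∂m, g x < ∞) (hg0 : ∀ᵐ x ∂m, 0 < g x) :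
    ∃ c ≠ ∞, ∀ᵐ x ∂m, f x = c * g x := by
  obtain ⟨c, hc⟩ := herg.ae_eq_const_of_ae_eq_comp₀ (g := fun x => f x / g x)
    (hf.measurable.div hg.measurable).nullMeasurable <| by
      filter_upwards [hf.ae_mul_eq, hg.ae_mul_eq] with x hfx hgx
      rw [← hfx, ← hgx, ENNReal.mul_div_mul_left _ _ (jacobian_ne_zero _ _ _ _ _)
        (jacobian_ne_top _ _ _ _ _), Function.comp_apply]
  refine ⟨c, ?_, ?_⟩
  · obtain ⟨x, hx, hfx, hgx⟩ := (hc.and (hf'.and hg0)).exists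
    exact (show f x / g x = c from hx) ▸ (ENNReal.div_lt_top hfx.ne hgx.ne').ne
  · filter_upwards [hc, hg', hg0] with x hx hgx hgx0
    rw [← show f x / g x = c from hx, ENNReal.div_mul_cancel hgx0.ne' hgx.ne]

end IsInvariantDensity

end InvariantDensities

section LowerDensity

variable {X : Type*}

/-- The lower limit of the averages of the Jacobians, whose positivity defines `M_{II_1}` outside
of `M_I`. -/
noncomputable def lowerDensity (T : Equiv.Perm X) (F : X → ℝ) (β : ℝ) (x : X) : ℝ≥0∞ :=
  liminf (fun n : ℕ => (n : ℝ≥0∞)⁻¹ * ∑ j ∈ Finset.range n, jacobian T F β (j + 1) x) atTop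

lemma MII1_eq (T : Equiv.Perm X) (F : X → ℝ) (β : ℝ) :
    MII1 T F β = {x | 0 < lowerDensity T F β x} \ MI T F β := by
  have h (x : X) (n : ℕ) :
      ENNReal.ofReal ((1 / (n : ℝ)) * ∑ j ∈ Finset.Icc 1 n, Real.exp (β * S T F (j : ℤ) x)) =
        (n : ℝ≥0∞)⁻¹ * ∑ j ∈ Finset.range n, jacobian T F β (j + 1) x := by
    rcases n.eq_zero_or_pos with rfl | hn
    · simp
    · rw [ENNReal.ofReal_mul (by positivity), one_div,
        ENNReal.ofReal_inv_of_pos (Nat.cast_pos.2 hn), ENNReal.ofReal_natCast,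
        ENNReal.ofReal_sum_of_nonneg fun j _ => (Real.exp_pos _).le, Finset.range_eq_Ico,
        ← Finset.Ico_add_one_right_eq_Icc,
        ← Finset.sum_Ico_add' (fun j : ℕ => ENNReal.ofReal (Real.exp (β * S T F j x))) 0 n 1]
      simp only [Nat.cast_add, Nat.cast_one, jacobian]
  simp only [MII1, lowerDensity, h]

lemma lowerDensity_zero_pos (T : Equiv.Perm X) (F : X → ℝ) (x : X) : 0 < lowerDensity T F 0 x := by
  refine zero_lt_one.trans_le (le_liminf_of_le (by isBoundedDefault) ?_)
  filter_upwards [eventually_ne_atTop 0] with n hn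
  simp [jacobian, ENNReal.inv_mul_cancel, hn]

lemma sum_range_succ_jacobian (T : Equiv.Perm X) (F : X → ℝ) (β : ℝ) (n : ℕ) (x : X) :
    ∑ j ∈ Finset.range (n + 1), jacobian T F β (j + 1) x =
      jacobian T F β 1 x * ∑ j ∈ Finset.range n, jacobian T F β (j + 1) (T x) +
        jacobian T F β 1 x := by
  simp [jacobian_add_one, ← Finset.mul_sum, Finset.sum_range_succ' _ n]

lemma lowerDensity_le (T : Equiv.Perm X) (F : X → ℝ) (β : ℝ) (x : X) :
    lowerDensity T F β x ≤ jacobian T F β 1 x * lowerDensity T F β (T x) := by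
  have hzero : Tendsto (fun n : ℕ => (n : ℝ≥0∞)⁻¹ * jacobian T F β 1 x) atTop (nhds 0) := by
    simpa using ENNReal.Tendsto.mul_const ENNReal.tendsto_inv_nat_nhds_zero
      (.inr (jacobian_ne_top T F β 1 x))
  rw [lowerDensity, lowerDensity,
    ← ENNReal.liminf_const_mul_of_ne_top (jacobian_ne_top T F β 1 x), ← liminf_nat_add _ 1,
    ← ENNReal.liminf_add_of_right_tendsto_zero hzero (fun n : ℕ => jacobian T F β 1 x * _)]
  refine liminf_le_liminf (.of_forall fun n => ?_)
  rw [sum_range_succ_jacobian, Pi.add_apply]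
  calc ((n + 1 : ℕ) : ℝ≥0∞)⁻¹ * (jacobian T F β 1 x *
          ∑ j ∈ Finset.range n, jacobian T F β (j + 1) (T x) + jacobian T F β 1 x)
      ≤ (n : ℝ≥0∞)⁻¹ * (jacobian T F β 1 x *
          ∑ j ∈ Finset.range n, jacobian T F β (j + 1) (T x) + jacobian T F β 1 x) := by
        gcongr
        exact n.le_succ
    _ = _ := by ring

lemma lowerDensity_pos_of_birkhoffSum {T : Equiv.Perm X} {F : X → ℝ} {β : ℝ} {x : X} {h : X → ℝ}
    (hh : ∀ y, 0 ≤ h y) {a : ℝ≥0∞} (ha : a ≠ 0)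
    (hJ : ∀ j : ℕ, a * ENNReal.ofReal (h (T^[j] (T x))) ≤ jacobian T F β (j + 1) x)
    {c : ℝ} (hc : 0 < c) (hsum : ∀ n : ℕ, c * n ≤ birkhoffSum T h n (T x)) :
    0 < lowerDensity T F β x := by
  refine (ENNReal.mul_pos ha (ENNReal.ofReal_pos.2 hc).ne').trans_le
    (le_liminf_of_le (by isBoundedDefault) ?_)
  filter_upwards [eventually_ne_atTop 0] with n hn
  calc a * ENNReal.ofReal c
      = (n : ℝ≥0∞)⁻¹ * (a * ENNReal.ofReal (c * n)) := by
        rw [mul_comm c, ENNReal.ofReal_mul n.cast_nonneg, ENNReal.ofReal_natCast,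
          mul_left_comm a, ENNReal.inv_mul_cancel_left (Nat.cast_ne_zero.2 hn)
            (ENNReal.natCast_ne_top n)]
    _ ≤ (n : ℝ≥0∞)⁻¹ * (a * ∑ j ∈ Finset.range n, ENNReal.ofReal (h (T^[j] (T x)))) := by
        rw [← ENNReal.ofReal_sum_of_nonneg fun j _ => hh _]
        gcongr
        exact hsum n
    _ ≤ (n : ℝ≥0∞)⁻¹ * ∑ j ∈ Finset.range n, jacobian T F β (j + 1) x := by
        rw [Finset.mul_sum]
        gcongr with j
        exact hJ j

variable [MeasurableSpace X] {φ : X ≃ᵐ X} {F : X → ℝ} {β : ℝ} {m : Measure X}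

lemma measurable_average_jacobian (φ : X ≃ᵐ X) (hF : Measurable F) (β : ℝ) (n : ℕ) :
    Measurable fun x =>
      (n : ℝ≥0∞)⁻¹ * ∑ j ∈ Finset.range n, jacobian φ.toEquiv F β (j + 1) x :=
  (Finset.measurable_sum _ fun (j : ℕ) _ => measurable_jacobian φ hF β (j + 1)).const_mul _

lemma measurable_lowerDensity (φ : X ≃ᵐ X) (hF : Measurable F) (β : ℝ) :
    Measurable (lowerDensity φ.toEquiv F β) :=
  .liminf fun n => measurable_average_jacobian φ hF β n

lemma measurableSet_MII1 [MeasurableSpace.CountablySeparated X] (φ : X ≃ᵐ X) (hF : Measurable F)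
    (β : ℝ) : MeasurableSet (MII1 φ.toEquiv F β) :=
  MII1_eq φ.toEquiv F β ▸
    (measurableSet_lt measurable_const (measurable_lowerDensity φ hF β)).diff
      (measurableSet_MI φ hF β)

namespace IsConformal

lemma lintegral_lowerDensity_le (hm : IsConformal φ.toEquiv F β m) (hF : Measurable F) :
    ∫⁻ x, lowerDensity φ.toEquiv F β x ∂m ≤ 1 := by
  refine (lintegral_liminf_le (measurable_average_jacobian φ hF β)).trans
    (liminf_le_of_le (by isBoundedDefault) fun b hb => ?_)
  obtain ⟨n, hn⟩ := hb.exists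
  refine hn.trans ?_
  have hsum : ∫⁻ x, ∑ j ∈ Finset.range n, jacobian φ.toEquiv F β (j + 1) x ∂m = n := by
    rw [lintegral_finsetSum _ fun (j : ℕ) _ => measurable_jacobian φ hF β (j + 1),
      Finset.sum_congr rfl fun j _ => by exact_mod_cast hm.lintegral_jacobian hF (j + 1)]
    simp
  rw [lintegral_const_mul _ <|
    Finset.measurable_sum _ fun (j : ℕ) _ => measurable_jacobian φ hF β (j + 1), hsum]
  exact ENNReal.inv_mul_le_one _

lemma isInvariantDensity_lowerDensity (hm : IsConformal φ.toEquiv F β m) (hF : Measurable F) :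
    IsInvariantDensity φ F β m (lowerDensity φ.toEquiv F β) := by
  have hD := measurable_lowerDensity φ hF β
  refine ⟨hD, EventuallyEq.symm <| ae_eq_of_ae_le_of_lintegral_le
    (ae_of_all _ (lowerDensity_le φ.toEquiv F β))
    ((hm.lintegral_lowerDensity_le hF).trans_lt ENNReal.one_lt_top).ne
    ((measurable_jacobian φ hF β 1).mul (hD.comp φ.measurable)).aemeasurable
    (hm.lintegral_jacobian_one_mul hF hD).le⟩

lemma isFiniteMeasure_withDensity_lowerDensity (hm : IsConformal φ.toEquiv F β m)
    (hF : Measurable F) : IsFiniteMeasure (m.withDensity (lowerDensity φ.toEquiv F β)) :=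
  isFiniteMeasure_withDensity ((hm.lintegral_lowerDensity_le hF).trans_lt ENNReal.one_lt_top).ne

lemma ae_lowerDensity_pos_or (hm : IsConformal φ.toEquiv F β m) (hF : Measurable F)
    (herg : PreErgodic φ m) :
    (∀ᵐ x ∂m, 0 < lowerDensity φ.toEquiv F β x) ∨ ∀ᵐ x ∂m, ¬ 0 < lowerDensity φ.toEquiv F β x := by
  refine (hm.quasiErgodic hF herg).ae_mem_or_ae_notMem₀
    (s := {x | 0 < lowerDensity φ.toEquiv F β x})
    (measurableSet_lt measurable_const (measurable_lowerDensity φ hF β)).nullMeasurableSet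
    (Eventually.set_eq ?_)
  filter_upwards [(hm.isInvariantDensity_lowerDensity hF).ae_mul_eq] with x hx
  simp only [Set.mem_preimage, Set.mem_ofPred_eq]
  rw [← hx]
  simp [pos_iff_ne_zero, jacobian_ne_zero]

lemma ae_lowerDensity_pos_of_invariant (hm : IsConformal φ.toEquiv F β m) (hF : Measurable F)
    {ν : Measure X} [IsFiniteMeasure ν] (hν : MeasurePreserving φ ν ν) (he : Equivalent m ν) :
    ∀ᵐ x ∂m, 0 < lowerDensity φ.toEquiv F β x := by
  have := hm.prob
  have hq := hm.quasiMeasurePreserving hF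
  have hg := hm.isInvariantDensity_rnDeriv hF hν he.2
  set g := ν.rnDeriv m
  have hgpos : ∀ᵐ x ∂m, 0 < g x := Measure.rnDeriv_pos' he.1
  set h : X → ℝ := fun x => (g x)⁻¹.toReal
  have hhpos : ∀ᵐ x ∂ν, 0 < h x := he.2.ae_le <| by
    filter_upwards [hgpos, Measure.rnDeriv_lt_top ν m] with x hx hx'
    exact ENNReal.toReal_pos (ENNReal.inv_ne_zero.2 hx'.ne) (ENNReal.inv_ne_top.2 hx.ne')
  have hbirk : ∀ᵐ x ∂m, ∃ c > 0, ∀ n : ℕ, c * n ≤ birkhoffSum φ h n x :=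
    he.1.ae_le (ae_exists_pos_mul_le_birkhoffSum hν hg.measurable.inv.ennreal_toReal hhpos)
  filter_upwards [hgpos, hg.ae_jacobian_mul_iterate hq, hq.ae hbirk] with x hgx hJ ⟨c, hc, hcn⟩
  refine lowerDensity_pos_of_birkhoffSum (fun _ => ENNReal.toReal_nonneg) hgx.ne' (fun j => ?_)
    hc hcn
  rw [← hJ (j + 1), mul_assoc, Nat.cast_succ, Function.iterate_succ_apply]
  refine mul_le_of_le_one_right' ((mul_le_mul_right ENNReal.ofReal_toReal_le _).trans ?_)
  exact ENNReal.mul_inv_le_one _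

end IsConformal

end LowerDensity

section Coboundaries

variable {X : Type*} [MeasurableSpace X] {φ : X ≃ᵐ X} {F : X → ℝ} {β : ℝ} {m : Measure X}

/-- `f` is, almost everywhere, the coboundary `u ∘ φ - u` of a measurable function `u`. -/
def IsAECoboundary (φ : X → X) (f : X → ℝ) (m : Measure X) : Prop :=
  ∃ u : X → ℝ, Measurable u ∧ ∀ᵐ x ∂m, f x = u (φ x) - u x

namespace IsConformal

lemma exists_equivalent_of_isAECoboundary (hm : IsConformal φ.toEquiv F β m) (hF : Measurable F)
    (h : IsAECoboundary φ (fun x => β * F x) m) :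
    ∃ ν : Measure X, SigmaFinite ν ∧ MeasurePreserving φ ν ν ∧ Equivalent m ν := by
  have := hm.prob
  obtain ⟨u, hu, hcob⟩ := h
  have hg : Measurable fun x => ENNReal.ofReal (Real.exp (-u x)) :=
    (Real.measurable_exp.comp hu.neg).ennreal_ofReal
  refine ⟨m.withDensity fun x => ENNReal.ofReal (Real.exp (-u x)), SigmaFinite.withDensity_ofReal _,
    (hm.measurePreserving_withDensity_iff hF hg).2 ⟨hg, ?_⟩,
    equivalent_withDensity hg (ae_of_all _ fun x => (ENNReal.ofReal_pos.2 (Real.exp_pos _)).ne')⟩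
  filter_upwards [hcob] with x hx
  rw [jacobian_one, hx, ← ENNReal.ofReal_mul (Real.exp_pos _).le, ← Real.exp_add]
  ring_nf

lemma isAECoboundary_of_equivalent (hm : IsConformal φ.toEquiv F β m) (hF : Measurable F)
    {ν : Measure X} [SigmaFinite ν] (hν : MeasurePreserving φ ν ν) (he : Equivalent m ν) :
    IsAECoboundary φ (fun x => β * F x) m := by
  have := hm.prob
  have hg := hm.isInvariantDensity_rnDeriv hF hν he.2
  have hpos : ∀ᵐ x ∂m, 0 < (ν.rnDeriv m x).toReal := by
    filter_upwards [Measure.rnDeriv_pos' he.1, Measure.rnDeriv_lt_top ν m] with x h₀ h₁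
    exact ENNReal.toReal_pos h₀.ne' h₁.ne
  refine ⟨fun x => -Real.log (ν.rnDeriv m x).toReal,
    (Real.measurable_log.comp hg.measurable.ennreal_toReal).neg, ?_⟩
  filter_upwards [(hm.quasiMeasurePreserving hF).ae hpos, hg.ae_mul_eq] with x hφx hx
  rw [← hx, ENNReal.toReal_mul, jacobian_one, ENNReal.toReal_ofReal (Real.exp_pos _).le,
    Real.log_mul (Real.exp_pos _).ne' hφx.ne', Real.log_exp]
  ring

lemma exists_invariant_isCoboundary (hm : IsConformal φ.toEquiv F β m) (hF : Measurable F)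
    (h : IsAECoboundary φ (fun x => β * F x) m) :
    ∃ A, MeasurableSet A ∧ φ ⁻¹' A = A ∧ m Aᶜ = 0 ∧
      ∃ u : X → ℝ, Measurable u ∧ ∀ x ∈ A, β * F x = u (φ x) - u x := by
  obtain ⟨u, hu, hcob⟩ := h
  have hG : MeasurableSet {x | β * F x = u (φ x) - u x} :=
    measurableSet_eq_fun (hF.const_mul β) ((hu.comp φ.measurable).sub hu)
  obtain ⟨A, hAG, hA, hinv, hA0⟩ := exists_invariant_subset (hm.quasiMeasurePreserving hF)
    hm.quasiMeasurePreserving_symm hG hcob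
  exact ⟨A, hA, hinv, hA0, u, hu, hAG⟩

lemma exists_isMIII_null (hm : IsConformal φ.toEquiv F β m) (hF : Measurable F)
    (h : IsAECoboundary φ (fun x => β * F x) m) : ∃ M, IsMIII φ.toEquiv F β m M ∧ m M = 0 := by
  obtain ⟨A, hA, hinv, hA0, u, hu, hcob⟩ := hm.exists_invariant_isCoboundary hF h
  exact ⟨Aᶜ, ⟨hA.compl, congrArg compl hinv, ⟨u, hu, by rwa [compl_compl]⟩,
    fun B hB _ _ _ => measure_mono_null hB hA0⟩, hA0⟩

lemma isTypeIII_iff_not_isAECoboundary (hm : IsConformal φ.toEquiv F β m) (hF : Measurable F)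
    (herg : PreErgodic φ m) :
    IsTypeIII φ.toEquiv F β m ↔ ¬ IsAECoboundary φ (fun x => β * F x) m := by
  have := hm.prob
  constructor
  · rintro ⟨M, hM, hM1⟩ h
    obtain ⟨A, hA, hinv, hA0, u, hu, hcob⟩ := hm.exists_invariant_isCoboundary hF h
    have hAM : m (M ∩ A) = 0 := hM.null_of_sub _ Set.inter_subset_left (hM.measurableSet.inter hA)
      (congrArg₂ (· ∩ ·) hM.invariant hinv) ⟨u, hu, fun x hx => hcob x hx.2⟩
    rw [measure_inter_conull hA0, hM1] at hAM
    exact one_ne_zero hAM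
  · intro h
    refine ⟨Set.univ, ⟨.univ, rfl, ⟨0, measurable_zero, by simp⟩, ?_⟩, measure_univ⟩
    rintro A - hA hinv ⟨u, hu, hcob⟩
    exact (herg.measure_self_or_compl_eq_zero hA hinv).resolve_right fun hA0 =>
      h ⟨u, hu, mem_of_superset (mem_ae_iff.2 hA0) hcob⟩

end IsConformal

lemma exists_invariant_absolutelyContinuous (h : Measure.QuasiMeasurePreserving φ m m)
    (h' : Measure.QuasiMeasurePreserving φ.symm m m) [SigmaFinite m] {ν : Measure X}
    [SigmaFinite ν] (hν : MeasurePreserving φ ν ν) (hs : ¬ m ⟂ₘ ν) :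
    ∃ ν' : Measure X, SigmaFinite ν' ∧ MeasurePreserving φ ν' ν' ∧ ν' ≪ m ∧ ν' ≠ 0 := by
  obtain ⟨N, hN, hνN, hmN⟩ := Measure.mutuallySingular_singularPart ν m
  obtain ⟨A, hAN, hA, hinv, hA0⟩ := exists_invariant_subset h h' hN hmN
  refine ⟨ν.restrict A, inferInstance, ?_, ?_, fun h0 => hs ⟨Aᶜ, hA.compl, hA0, ?_⟩⟩
  · simpa only [hinv] using hν.restrict_preimage hA
  · have hz : (ν.singularPart m).restrict A = 0 :=
      Measure.restrict_eq_zero.2 (measure_mono_null hAN hνN)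
    rw [ν.haveLebesgueDecomposition_add m, Measure.restrict_add, hz, zero_add]
    exact Measure.restrict_le_self.absolutelyContinuous.trans
      (withDensity_absolutelyContinuous _ _)
  · rwa [compl_compl, ← Measure.restrict_eq_zero]

end Coboundaries

namespace IsConformal

variable {X : Type*} [MeasurableSpace X] {φ : X ≃ᵐ X} {F : X → ℝ} {β : ℝ} {m : Measure X}

theorem isTypeIII_iff (hm : IsConformal φ.toEquiv F β m) (hF : Measurable F)
    (herg : PreErgodic φ m) :
    IsTypeIII φ.toEquiv F β m ↔
      ∀ ν : Measure X, SigmaFinite ν → MeasurePreserving φ ν ν → m ⟂ₘ ν := by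
  have := hm.prob
  rw [hm.isTypeIII_iff_not_isAECoboundary hF herg]
  constructor
  · intro h ν _ hν
    by_contra hs
    obtain ⟨ν', _, hν', hac, hν'0⟩ := exists_invariant_absolutelyContinuous
      (hm.quasiMeasurePreserving hF) hm.quasiMeasurePreserving_symm hν hs
    exact h (hm.isAECoboundary_of_equivalent hF hν'
      ⟨absolutelyContinuous_of_invariant herg hν' hac hν'0, hac⟩)
  · intro h hcob
    obtain ⟨ν, hσ, hν, he⟩ := hm.exists_equivalent_of_isAECoboundary hF hcob
    exact IsProbabilityMeasure.ne_zero m <|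
      (Measure.MutuallySingular.self_iff m).1 ((h ν hσ hν).mono_ac .rfl he.1)

lemma not_ae_lowerDensity_pos_of_infinite (hm : IsConformal φ.toEquiv F β m) (hF : Measurable F)
    (herg : PreErgodic φ m) {ν : Measure X} [SigmaFinite ν] (hν : MeasurePreserving φ ν ν)
    (hac : ν ≪ m) (htop : ν Set.univ = ∞) :
    ¬ ∀ᵐ x ∂m, 0 < lowerDensity φ.toEquiv F β x := by
  have := hm.prob
  intro hpos
  have hD := hm.isInvariantDensity_lowerDensity hF
  have hDint := (hm.lintegral_lowerDensity_le hF).trans_lt ENNReal.one_lt_top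
  obtain ⟨c, hc, hcD⟩ := (hm.isInvariantDensity_rnDeriv hF hν hac).exists_ae_eq_const_mul
    (hm.quasiErgodic hF herg) hD (Measure.rnDeriv_lt_top ν m) (ae_lt_top hD.measurable hDint.ne)
    hpos
  refine (ENNReal.mul_lt_top hc.lt_top hDint).ne ?_
  rw [← lintegral_const_mul c hD.measurable, ← lintegral_congr_ae hcD,
    Measure.lintegral_rnDeriv hac, htop]

lemma nullSingletonClass_of_measure_MI_union_MII1_eq_zero [MeasurableSingletonClass X]
    (hm : IsConformal φ.toEquiv F β m) (h : m (MI φ.toEquiv F β ∪ MII1 φ.toEquiv F β) = 0) :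
    NullSingletonClass m := by
  refine ⟨fun x => by_contra fun hx => ?_⟩
  refine hx (measure_mono_null (Set.singleton_subset_iff.2 ?_) h)
  by_cases hMI : x ∈ MI φ.toEquiv F β
  · exact .inl hMI
  · obtain ⟨rfl, -⟩ := (hm.mem_MI_or_not_isFCyclic hx).resolve_left hMI
    exact .inr (MII1_eq φ.toEquiv F 0 ▸ ⟨lowerDensity_zero_pos _ F x, hMI⟩)

variable [MeasurableSpace.CountablySeparated X]

attribute [local instance] MeasurableSpace.measurableSingletonClass_of_countablySeparated

theorem isTypeIp_iff (hm : IsConformal φ.toEquiv F β m) (hF : Measurable F)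
    (herg : PreErgodic φ m) {p : ℕ} (hp : 1 ≤ p) :
    IsTypeIp φ.toEquiv F m p ↔ IsAtomic m ∧ ∃ x : X, IsFCyclic φ.toEquiv F x ∧
      Function.minimalPeriod φ x = p ∧ m (orbit φ.toEquiv x) = 1 := by
  have := hm.prob
  constructor
  · intro h
    obtain ⟨x, hx, hx0⟩ :=
      hm.exists_measure_singleton_ne_zero_of_MIp hF herg hp (h.trans_ne one_ne_zero)
    have horbit := measure_orbit_eq_one herg hx0
    obtain ⟨hcyc, hper⟩ := (mem_MIp_iff hp).1 hx
    exact ⟨isAtomic_of_orbit horbit, x, hcyc, hper, horbit⟩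
  · rintro ⟨-, x, hcyc, hper, horbit⟩
    refine prob_le_one.antisymm (horbit.symm.trans_le (measure_mono ?_))
    rintro _ ⟨k, rfl⟩
    exact zpow_mem_MIp ((mem_MIp_iff hp).2 ⟨hcyc, hper⟩) k

theorem isTypeIinf_iff (hm : IsConformal φ.toEquiv F β m) (hF : Measurable F)
    (herg : PreErgodic φ m) :
    IsTypeIinf φ.toEquiv F β m ↔ IsAtomic m ∧ ∃ x : X, (orbit φ.toEquiv x).Infinite ∧
      m (orbit φ.toEquiv x) = 1 := by
  have := hm.prob
  constructor
  · intro h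
    obtain ⟨x, hx, hx0⟩ :=
      hm.exists_measure_singleton_ne_zero_of_MIinf hF herg (h.trans_ne one_ne_zero)
    have horbit := measure_orbit_eq_one herg hx0
    exact ⟨isAtomic_of_orbit horbit, x,
      fun hfin => notMem_periodicPts_of_mem_MIinf hx (orbit_finite_iff.1 hfin), horbit⟩
  · rintro ⟨-, x, hinf, horbit⟩
    have hx0 := hm.measure_singleton_ne_zero_of_orbit (horbit.trans_ne one_ne_zero)
    refine prob_le_one.antisymm (horbit.symm.trans_le (measure_mono ?_))
    rintro _ ⟨k, rfl⟩
    exact zpow_mem_MIinf (hm.mem_MIinf_of_orbit_infinite hx0 hinf) k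

lemma isTypeII1_iff_ae_lowerDensity_pos [NullSingletonClass m] (hm : IsConformal φ.toEquiv F β m)
    (hF : Measurable F) (herg : PreErgodic φ m) :
    IsTypeII1 φ.toEquiv F β m ↔ ∀ᵐ x ∂m, 0 < lowerDensity φ.toEquiv F β x := by
  have := hm.prob
  rw [IsTypeII1, MII1_eq, measure_sdiff_null (hm.measure_MI_eq_zero hF herg),
    ← prob_compl_eq_zero_iff (measurableSet_lt measurable_const (measurable_lowerDensity φ hF β))]
  rfl

lemma nullSingletonClass_of_isTypeII1 (hm : IsConformal φ.toEquiv F β m) (hF : Measurable F)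
    (herg : PreErgodic φ m)
    (hβ : β = 0 → ∀ x ∈ Function.periodicPts φ, m (orbit φ.toEquiv x) = 1 →
      IsFCyclic φ.toEquiv F x)
    (h : IsTypeII1 φ.toEquiv F β m) : NullSingletonClass m := by
  have := hm.prob
  refine ⟨fun x => by_contra fun hx => ?_⟩
  rcases hm.mem_MI_or_not_isFCyclic hx with hMI | ⟨hβ0, hper, hcyc⟩
  · have hMII1 : m (MII1 φ.toEquiv F β)ᶜ = 0 :=
      (prob_compl_eq_zero_iff (measurableSet_MII1 φ hF β)).2 h
    exact hx (measure_mono_null (Set.singleton_subset_iff.2 fun hx' => hx'.2 hMI) hMII1)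
  · exact hcyc (hβ hβ0 x hper (measure_orbit_eq_one herg hx))

theorem isTypeII1_iff (hm : IsConformal φ.toEquiv F β m) (hF : Measurable F)
    (herg : PreErgodic φ m)
    (hβ : β = 0 → ∀ x ∈ Function.periodicPts φ, m (orbit φ.toEquiv x) = 1 →
      IsFCyclic φ.toEquiv F x) :
    IsTypeII1 φ.toEquiv F β m ↔ ∃ ν : Measure X, IsProbabilityMeasure ν ∧
      NullSingletonClass ν ∧ MeasurePreserving φ ν ν ∧ Equivalent m ν := by
  have := hm.prob
  constructor
  · intro h
    have := hm.nullSingletonClass_of_isTypeII1 hF herg hβ h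
    have hD := hm.isInvariantDensity_lowerDensity hF
    have hpos := (hm.isTypeII1_iff_ae_lowerDensity_pos hF herg).1 h
    have := hm.isFiniteMeasure_withDensity_lowerDensity hF
    have hinv := (hm.measurePreserving_withDensity_iff hF hD.measurable).2 hD
    obtain ⟨hmν, hνm⟩ := equivalent_withDensity hD.measurable (hpos.mono fun x hx => hx.ne')
    set ν := m.withDensity (lowerDensity φ.toEquiv F β)
    have : NeZero ν := ⟨fun h0 => IsProbabilityMeasure.ne_zero m (by simpa [h0] using hmν)⟩
    have hac : (ν Set.univ)⁻¹ • ν ≪ m := hνm.smul_left _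
    exact ⟨(ν Set.univ)⁻¹ • ν, inferInstance, ⟨fun x => hac (measure_singleton x)⟩,
      hinv.smul_measure _, hmν.trans (Measure.absolutelyContinuous_smul
        (ENNReal.inv_ne_zero.2 (measure_ne_top ν _))), hac⟩
  · rintro ⟨ν, _, _, hinv, he⟩
    have : NullSingletonClass m := ⟨fun x => he.1 (measure_singleton x)⟩
    exact (hm.isTypeII1_iff_ae_lowerDensity_pos hF herg).2
      (hm.ae_lowerDensity_pos_of_invariant hF hinv he)

lemma isTypeIIinf_iff_isAECoboundary (hm : IsConformal φ.toEquiv F β m) (hF : Measurable F) :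
    IsTypeIIinf φ.toEquiv F β m ↔
      m (MI φ.toEquiv F β ∪ MII1 φ.toEquiv F β) = 0 ∧ IsAECoboundary φ (fun x => β * F x) m := by
  have := hm.prob
  have hmeas := (measurableSet_MI φ hF β).union (measurableSet_MII1 φ hF β)
  constructor
  · rintro ⟨M, hM, h⟩
    rw [prob_compl_eq_one_iff (hmeas.union hM.measurableSet), measure_union_null_iff] at h
    obtain ⟨u, hu, hcob⟩ := hM.exists_off
    exact ⟨h.1, u, hu, (measure_eq_zero_iff_ae_notMem.1 h.2).mono hcob⟩
  · rintro ⟨h, hcob⟩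
    obtain ⟨M, hM, hM0⟩ := hm.exists_isMIII_null hF hcob
    exact ⟨M, hM, (prob_compl_eq_one_iff (hmeas.union hM.measurableSet)).2
      (measure_union_null h hM0)⟩

theorem isTypeIIinf_iff (hm : IsConformal φ.toEquiv F β m) (hF : Measurable F)
    (herg : PreErgodic φ m) :
    IsTypeIIinf φ.toEquiv F β m ↔ ∃ ν : Measure X, SigmaFinite ν ∧ ν Set.univ = ∞ ∧
      NullSingletonClass ν ∧ MeasurePreserving φ ν ν ∧ Equivalent m ν := by
  have := hm.prob
  rw [hm.isTypeIIinf_iff_isAECoboundary hF]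
  constructor
  · rintro ⟨h, hcob⟩
    have := hm.nullSingletonClass_of_measure_MI_union_MII1_eq_zero h
    obtain ⟨ν, hσ, hν, he⟩ := hm.exists_equivalent_of_isAECoboundary hF hcob
    refine ⟨ν, hσ, by_contra fun hfin => ?_, ⟨fun x => he.2 (measure_singleton x)⟩, hν, he⟩
    have : IsFiniteMeasure ν := ⟨lt_top_iff_ne_top.2 hfin⟩
    have hII1 : m (MII1 φ.toEquiv F β) = 1 := (hm.isTypeII1_iff_ae_lowerDensity_pos hF herg).2
      (hm.ae_lowerDensity_pos_of_invariant hF hν he)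
    exact one_ne_zero (hII1.symm.trans (measure_mono_null Set.subset_union_right h))
  · rintro ⟨ν, _, htop, _, hν, he⟩
    have : NullSingletonClass m := ⟨fun x => he.1 (measure_singleton x)⟩
    refine ⟨measure_union_null (hm.measure_MI_eq_zero hF herg) ?_,
      hm.isAECoboundary_of_equivalent hF hν he⟩
    have hD0 := (hm.ae_lowerDensity_pos_or hF herg).resolve_left
      (hm.not_ae_lowerDensity_pos_of_infinite hF herg hν he.2 htop)
    rw [MII1_eq]
    exact measure_mono_null Set.sdiff_subset (measure_eq_zero_iff_ae_notMem.2 hD0)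

end IsConformal

end ConformalType

theorem theorem4p10_general {X : Type*} [MeasurableSpace X]
    [MeasurableSpace.CountablySeparated X] (φ : X ≃ᵐ X) {F : X → ℝ} (hF : Measurable F) (β : ℝ)
    (m : Measure X)
    (hm : ConformalType.IsConformal φ.toEquiv F β m) (herg : PreErgodic φ m) :
    (∀ p : ℕ, 1 ≤ p →
      (ConformalType.IsTypeIp φ.toEquiv F m p ↔
        ConformalType.IsAtomic m ∧
          ∃ x : X, ConformalType.IsFCyclic φ.toEquiv F x ∧
            Function.minimalPeriod φ x = p ∧ m (ConformalType.orbit φ.toEquiv x) = 1)) ∧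
    (ConformalType.IsTypeIinf φ.toEquiv F β m ↔
      ConformalType.IsAtomic m ∧
        ∃ x : X, (ConformalType.orbit φ.toEquiv x).Infinite ∧
          m (ConformalType.orbit φ.toEquiv x) = 1) ∧
    ((β = 0 → ∀ x ∈ Function.periodicPts φ, m (ConformalType.orbit φ.toEquiv x) = 1 →
        ConformalType.IsFCyclic φ.toEquiv F x) →
      (ConformalType.IsTypeII1 φ.toEquiv F β m ↔
        ∃ ν : Measure X, IsProbabilityMeasure ν ∧ NullSingletonClass ν ∧ MeasurePreserving φ ν ν ∧
          ConformalType.Equivalent m ν)) ∧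
    (ConformalType.IsTypeIIinf φ.toEquiv F β m ↔
      ∃ ν : Measure X, SigmaFinite ν ∧ ν Set.univ = ∞ ∧ NullSingletonClass ν ∧
        MeasurePreserving φ ν ν ∧ ConformalType.Equivalent m ν) ∧
    (ConformalType.IsTypeIII φ.toEquiv F β m ↔
      ∀ ν : Measure X, SigmaFinite ν → MeasurePreserving φ ν ν → m ⟂ₘ ν) :=
  ⟨fun _ hp => hm.isTypeIp_iff hF herg hp, hm.isTypeIinf_iff hF herg,
    fun hβ => hm.isTypeII1_iff hF herg hβ, hm.isTypeIIinf_iff hF herg, hm.isTypeIII_iff hF herg⟩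

theorem theorem4p10 {X : Type*} [MetricSpace X] [CompactSpace X] [MeasurableSpace X]
    [BorelSpace X] (φ : X ≃ₜ X) (F : C(X, ℝ)) (β : ℝ) (m : Measure X)
    (hm : ConformalType.IsConformal φ.toEquiv F β m) (herg : PreErgodic φ m) :
    (∀ p : ℕ, 1 ≤ p →
      (ConformalType.IsTypeIp φ.toEquiv F m p ↔
        ConformalType.IsAtomic m ∧
          ∃ x : X, ConformalType.IsFCyclic φ.toEquiv F x ∧
            Function.minimalPeriod φ x = p ∧ m (ConformalType.orbit φ.toEquiv x) = 1)) ∧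
    (ConformalType.IsTypeIinf φ.toEquiv F β m ↔
      ConformalType.IsAtomic m ∧
        ∃ x : X, (ConformalType.orbit φ.toEquiv x).Infinite ∧
          m (ConformalType.orbit φ.toEquiv x) = 1) ∧
    ((β = 0 → ∀ x ∈ Function.periodicPts φ, m (ConformalType.orbit φ.toEquiv x) = 1 →
        ConformalType.IsFCyclic φ.toEquiv F x) →
      (ConformalType.IsTypeII1 φ.toEquiv F β m ↔
        ∃ ν : Measure X, IsProbabilityMeasure ν ∧ NullSingletonClass ν ∧ MeasurePreserving φ ν ν ∧
          ConformalType.Equivalent m ν)) ∧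
    (ConformalType.IsTypeIIinf φ.toEquiv F β m ↔
      ∃ ν : Measure X, SigmaFinite ν ∧ ν Set.univ = ∞ ∧ NullSingletonClass ν ∧ MeasurePreserving φ ν ν ∧
        ConformalType.Equivalent m ν) ∧
    (ConformalType.IsTypeIII φ.toEquiv F β m ↔
      ∀ ν : Measure X, SigmaFinite ν → MeasurePreserving φ ν ν → m ⟂ₘ ν) := by
  exact theorem4p10_general φ.toMeasurableEquiv F.continuous.measurable β m hm herg
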